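/- Let $q$ be a prime power with prime divisor $p$, let $j,k\ge 1$ be coprime integers with $p\nmid k$, and put $m=j+k$. Let $\bar L$ be an algebraically closed field containing $\mathbb F_q$ (for instance an algebraic closure of a field $L\supseteq\mathbb F_{q^m}$), let $\mathbb F_{q^k}\subseteq\bar L$ be its subfield with $q^k$ elements, and put $A=\mathbb F_q[T]$, $A_k=\mathbb F_{q^k}[T]$. A twisted polynomial $\sum_i g_i\tau^i$ with $g_i\in\bar L$ acts on $\bar L$ by $\mu\mapsto\sum_i g_i\mu^{q^i}$, products act by composition, and $\mathrm{Ker}$ denotes the set of zeros in $\bar L$. For $0\ne x\in\bar L$ put $$\lambda_x=x^{q^k-1}-\tau^k,\qquad Q_x=\sum_{i=0}^{j-1}x^{1-q^{k+i}}\tau^i+\sum_{i=0}^{k-1}x^{1-q^i}\tau^{j+i},$$ and let $\phi^x$ be the Drinfeld $A$-module with $\phi^x_T=-\tau^m+g(x)\tau^j+1$, $g(x)=x^{q^m-q^j}-x^{1-q^j}$, so that $\phi^x_T(x)=0$. Put $F(T)=1-(1-T)^k=T f(T)$ with $f(T)=\sum_{i=1}^k\binom ki(-T)^{i-1}$, and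 let $\Phi^x$ be the Drinfeld module with $\Phi^x_T=\phi^x_{F(T)}$; as $\Phi^x_T$ is a polynomial in $\tau^k$, it also makes $\bar L$ an $A_k$-module. For $n\ge 1$ let $\mathcal E_n(\phi^x)$ be the set of $\mathbb F_{q^k}$-subspaces $E\subseteq\mathrm{Ker}(\Phi^x_{T^n})$ that are $A$-submodules of $\bar L$ (via $\phi^x$) isomorphic to $A/(F(T)^n)$ and $A_k$-submodules of $\bar L$ (via $\Phi^x$) isomorphic to $A_k/(T^n)$. Let $$\mathcal E_n^*(\phi^x)=\{E\in\mathcal E_n(\phi^x): x\in\Phi^x_{T^{n-1}}\phi^x_{f(T)}E\}.$$ Theorem. Let $0\neq x_1\in\bar L$ and $n\ge2$, and let $$X_n=\{(x_2,\dots,x_n)\in\bar L^{\,n-1}: Q_{x_i}(x_{i+1})=x_i\text{ for }1\le i\le n-1\}$$ (all entries of such a tuple are automatically nonzero). There is a bijection $\Theta_n:\mathcal E_n^*(\phi^{x_1})\to X_n$ that is characterized as follows: for $E_n\in\mathcal E_n^*(\phi^{x_1})$ and $(x_2,\dots,x_n)\in X_n$ one has $\Theta_n(E_n)=(x_2,\dots,x_n)$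 if and only if (I) $E_n=\mathrm{Ker}(\lambda_{x_n}\cdots\lambda_{x_2}\lambda_{x_1})$, and (II) the set $H_n=\{h\in E_n:\Phi^{x_1}_{T^{n-1}}(h)=x_1\}$ is non-empty, and $x_n=\lambda_{x_{n-1}}\cdots\lambda_{x_1}(h)$ for every $h\in H_n$. Moreover $\mathcal E_n^*(\phi^{x_1})$ and $X_n$ are finite and both have exactly $q^{(m-1)(n-1)}$ elements. -/

import Mathlib

open Polynomial

namespace DrinfeldTower

noncomputable section

section TwistedPolynomials

variable (Fq : Type*) {Ω : Type*} [Field Fq] [Fintype Fq] [Field Ω] [Algebra Fq Ω]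

/-- The `q`-Frobenius `τ : z ↦ z ^ q`, where `q` is the cardinality of `Fq`, as an `Fq`-linear
endomorphism of `Ω`. A twisted polynomial `∑ gᵢ τ ^ i` over `Ω` is treated throughout as the
`Fq`-linear endomorphism `z ↦ ∑ gᵢ * z ^ (q ^ i)` of `Ω`; the product of twisted polynomials is
composition, and nothing is lost in this way when `Ω` is infinite. -/
def tau : Module.End Fq Ω := (FiniteField.frobeniusAlgHom Fq Ω).toLinearMap

/-- `φ_T = -τ ^ m + g τ ^ j + 1` with `m = j + k`: the value at `T` of the normalized Drinfeld
module with parameter `g`. -/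
def phiT (j k : ℕ) (g : Ω) : Module.End Fq Ω :=
  -(tau Fq ^ (j + k)) + g • tau Fq ^ j + 1

/-- The normalized Drinfeld module `a ↦ φ_a` on `Fq[T]` with parameter `g`. -/
def phi (j k : ℕ) (g : Ω) : Fq[X] →ₐ[Fq] Module.End Fq Ω :=
  aeval (phiT Fq j k g)

/-- The parameter `g(x) = x ^ (q ^ m - q ^ j) - x ^ (1 - q ^ j)` of the normalized Drinfeld module
`φ ^ x`, the one with `φ ^ x_T (x) = 0`. -/
def gOf (j k : ℕ) (x : Ω) : Ω :=
  x ^ ((Fintype.card Fq : ℤ) ^ (j + k) - (Fintype.card Fq : ℤ) ^ j)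
    - x ^ (1 - (Fintype.card Fq : ℤ) ^ j)

/-- The twisted polynomial `λ_x = x ^ (q ^ k - 1) - τ ^ k`. -/
def lam (k : ℕ) (x : Ω) : Module.End Fq Ω :=
  x ^ ((Fintype.card Fq : ℤ) ^ k - 1) • (1 : Module.End Fq Ω) - tau Fq ^ k

/-- The twisted polynomial
`Q_x = ∑_{i < j} x ^ (1 - q ^ (k + i)) τ ^ i + ∑_{i < k} x ^ (1 - q ^ i) τ ^ (j + i)`. -/
def Q (j k : ℕ) (x : Ω) : Module.End Fq Ω :=
  ∑ i ∈ Finset.range j, x ^ (1 - (Fintype.card Fq : ℤ) ^ (k + i)) • tau Fq ^ i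
    + ∑ i ∈ Finset.range k, x ^ (1 - (Fintype.card Fq : ℤ) ^ i) • tau Fq ^ (j + i)

/-- `F(T) = 1 - (1 - T) ^ k` in `Fq[T]`. -/
def FPoly (k : ℕ) : Fq[X] := 1 - (1 - X) ^ k

/-- `f(T) = ∑_{i = 1}^k (k choose i) (-T) ^ (i - 1)`, so that `F(T) = T f(T)`. -/
def fPoly (k : ℕ) : Fq[X] :=
  ∑ i ∈ Finset.Icc 1 k, (k.choose i : Fq[X]) * (-X) ^ (i - 1)

/-- The Drinfeld module `Φ : T ↦ φ_{F(T)}` on `Fq[T]`. -/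
def Phi (j k : ℕ) (g : Ω) : Fq[X] →ₐ[Fq] Module.End Fq Ω :=
  aeval (phi Fq j k g (FPoly Fq k))

variable (Ω) in
/-- The subfield `{z | z ^ (q ^ k) = z}` of `Ω`; it is the field with `q ^ k` elements inside `Ω`
when `Ω` is algebraically closed and `1 ≤ k`. -/
def Fqk (k : ℕ) : Subfield Ω :=
  ((FiniteField.frobeniusAlgHom Fq Ω ^ k : Ω →ₐ[Fq] Ω) : Ω →+* Ω).eqLocusField (RingHom.id Ω)

theorem tau_pow_apply (i : ℕ) (z : Ω) : (tau Fq ^ i) z = z ^ (Fintype.card Fq ^ i) := by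
  induction i with
  | zero => simp
  | succ i ih =>
    rw [pow_succ', Module.End.mul_apply, ih, pow_succ, pow_mul]
    rfl

theorem mem_Fqk (k : ℕ) (z : Ω) : z ∈ Fqk Fq Ω k ↔ z ^ (Fintype.card Fq ^ k) = z := by
  have h : (FiniteField.frobeniusAlgHom Fq Ω ^ k : Ω →ₐ[Fq] Ω) z = (tau Fq ^ k) z := by
    rw [AlgHom.coe_pow, Module.End.coe_pow]
    rfl
  rw [← tau_pow_apply, ← h]
  rfl

theorem one_sub_phiT_pow_mul (j k : ℕ) (g μ : Ω) (hμ : μ ∈ Fqk Fq Ω k) (l : ℕ) (z : Ω) :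
    ((1 - phiT Fq j k g) ^ l) (μ * z)
      = μ ^ (Fintype.card Fq ^ (j * l)) * ((1 - phiT Fq j k g) ^ l) z := by
  induction l with
  | zero => simp
  | succ l ih =>
    have hμ' := (mem_Fqk Fq k μ).1 hμ
    have key : ∀ ν w : Ω, ν ^ (Fintype.card Fq ^ k) = ν →
        (1 - phiT Fq j k g) (ν * w)
          = ν ^ (Fintype.card Fq ^ j) * (1 - phiT Fq j k g) w := by
      intro ν w hν
      have h2 : ν ^ (Fintype.card Fq ^ (j + k)) = ν ^ (Fintype.card Fq ^ j) := by
        rw [add_comm, pow_add, pow_mul, hν]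
      simp only [phiT, LinearMap.sub_apply, LinearMap.add_apply, LinearMap.neg_apply,
        LinearMap.smul_apply, Module.End.one_apply, tau_pow_apply, mul_pow, h2, smul_eq_mul]
      ring
    rw [pow_succ', Module.End.mul_apply, ih, key, Module.End.mul_apply, ← pow_mul, ← pow_add,
      mul_add_one]
    rw [← pow_mul, mul_comm, pow_mul, hμ']

theorem phi_FPoly_mul (j k : ℕ) (g μ : Ω) (hμ : μ ∈ Fqk Fq Ω k) (z : Ω) :
    phi Fq j k g (FPoly Fq k) (μ * z) = μ * phi Fq j k g (FPoly Fq k) z := by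
  have h : phi Fq j k g (FPoly Fq k) = 1 - (1 - phiT Fq j k g) ^ k := by
    simp [phi, FPoly]
  have h3 : ∀ l : ℕ, μ ^ (Fintype.card Fq ^ (l * k)) = μ := by
    intro l
    induction l with
    | zero => simp
    | succ l ih => rw [add_one_mul, pow_add, pow_mul, ih, (mem_Fqk Fq k μ).1 hμ]
  rw [h, LinearMap.sub_apply, LinearMap.sub_apply, one_sub_phiT_pow_mul Fq j k g μ hμ, h3,
    Module.End.one_apply, Module.End.one_apply, mul_sub]

/-- `Φ_T = φ_{F(T)}` is a twisted polynomial in `τ ^ k`, hence linear over the field with `q ^ k`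
elements. It makes `Ω` a module over `A_k`, the polynomial ring in `T` over that field. -/
def PhiTk (j k : ℕ) (g : Ω) : Module.End (Fqk Fq Ω k) Ω where
  toFun z := phi Fq j k g (FPoly Fq k) z
  map_add' := map_add _
  map_smul' μ z := phi_FPoly_mul Fq j k g μ μ.2 z

end TwistedPolynomials

/-- Let `R[T]` act on the `R`-module `V` with `T` acting as the endomorphism `t`. The subset `E` of
`V` is an `R[T]`-submodule, and as such it is isomorphic to `R[T] / (a)`. -/
def IsSubmoduleIsoQuot {R V : Type*} [CommRing R] [AddCommGroup V] [Module R V]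
    (t : Module.End R V) (E : Set V) (a : R[X]) : Prop :=
  ∃ N : Submodule R[X] (Module.AEval' t),
    (∀ z : V, Module.AEval'.of t z ∈ N ↔ z ∈ E) ∧
      Nonempty (N ≃ₗ[R[X]] (R[X] ⧸ Ideal.span {a}))

section LevelStructures

variable (Fq : Type*) {Ω : Type*} [Field Fq] [Fintype Fq] [Field Ω] [Algebra Fq Ω]

/-- The set `𝓔_n(φ)` for the normalized Drinfeld module `φ` with parameter `g`: the subspaces `E`
of `Ω` over the field with `q ^ k` elements that are contained in `Ker Φ_{T ^ n}`, are
isomorphic to `A / (F(T) ^ n)` as `A`-submodules (through `φ`) and are isomorphic to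
`A_k / (T ^ n)` as `A_k`-submodules (through `Φ`). -/
def levelSet (j k n : ℕ) (g : Ω) : Set (Submodule (Fqk Fq Ω k) Ω) :=
  {E | (∀ z ∈ E, Phi Fq j k g (X ^ n) z = 0) ∧
    IsSubmoduleIsoQuot (phiT Fq j k g) (E : Set Ω) (FPoly Fq k ^ n) ∧
    IsSubmoduleIsoQuot (PhiTk Fq j k g) (E : Set Ω) ((X : (Fqk Fq Ω k)[X]) ^ n)}

/-- The set `𝓔_n^*(φ ^ x)`: those `E` in `𝓔_n(φ ^ x)` with `x ∈ Φ_{T ^ (n - 1)} φ_{f(T)} E`,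
where `φ = φ ^ x`. -/
def markedLevelSet (j k n : ℕ) (x : Ω) : Set (Submodule (Fqk Fq Ω k) Ω) :=
  {E | E ∈ levelSet Fq j k n (gOf Fq j k x) ∧
    ∃ z ∈ E, Phi Fq j k (gOf Fq j k x) (X ^ (n - 1))
      (phi Fq j k (gOf Fq j k x) (fPoly Fq k) z) = x}

/-- The sequence `x₁, x₂, …, x_n` (indexed from `1`) formed by `x₁` and a tuple
`y = (x₂, …, x_n)`; the values at the other indices are irrelevant. -/
def seq (n : ℕ) (x₁ : Ω) (y : Fin (n - 1) → Ω) (i : ℕ) : Ω :=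
  if h : 2 ≤ i ∧ i ≤ n then y ⟨i - 2, by omega⟩ else x₁

/-- The set `X_n` of the tuples `(x₂, …, x_n)` with `Q_{x_i}(x_{i+1}) = x_i` for `1 ≤ i < n`. -/
def solutionSet (j k n : ℕ) (x₁ : Ω) : Set (Fin (n - 1) → Ω) :=
  {y | ∀ i : ℕ, 1 ≤ i → i < n → Q Fq j k (seq n x₁ y i) (seq n x₁ y (i + 1)) = seq n x₁ y i}

/-- The product `λ_{x_l} ⋯ λ_{x_2} λ_{x_1}` for a sequence `x` indexed from `1`. -/
def lamProd (k : ℕ) (x : ℕ → Ω) : ℕ → Module.End Fq Ω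
  | 0 => 1
  | l + 1 => lam Fq k (x (l + 1)) * lamProd k x l

end LevelStructures

end

end DrinfeldTower

namespace DrinfeldTower

/-! Write `P` for `Φ_T` and `K` for the field with `q ^ k` elements. The kernel of `λ_x` is the line
`K x`. On it `1 - φ_T` is `μ x ↦ μ ^ (q ^ j) x`, so `φ_T` preserves this line and `λ_x` carries `φ ^
x` to a normalized module with parameter `gNext`; the equation `Q_x(y) = x` forces that module to be
`φ ^ y`. The decisive identity is `PhiTk_eq_Q_lam`: `P z = Q_x (λ_x z)` whenever `φ_T z` lies in `K
x`. Both sides are `x` times the trace of `φ_T z / x`.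

Membership in `markedLevelSet` amounts to `IsMarked`: `E` is stable under `φ_T` and is generated
over `A_k` by some `h` with `P ^ (n - 1) h = x₁`. From such an `h` put `x_{l+1} = λ_{x_l} ⋯ λ_{x_1}
(P ^ (n - 1 - l) h)`; stability and the decisive identity give the recursion. Conversely, for a
chain, any `h` that the first `n - 1` factors send to `x_n` satisfies these same formulas, by
descending induction. In both cases they show that the kernel of the full product is the `A_k`-span
of `h`, and that `h` determines the tuple. The cardinality comes from counting the roots of the
separable equations `Q_x(y) = x`. -/

theorem X_mul_fPoly {Fq : Type*} [Field Fq] (k : ℕ) : X * fPoly Fq k = FPoly Fq k := by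
  have h := (add_pow (-X : Fq[X]) 1 k)
  rw [Finset.sum_range_succ'] at h
  rw [FPoly, show (1 - X : Fq[X]) = -X + 1 by ring, h, fPoly, Finset.mul_sum,
    ← Finset.Ico_add_one_right_eq_Icc, Finset.sum_Ico_eq_sum_range]
  simp only [pow_zero, one_pow, Nat.choose_zero_right, Nat.cast_one, mul_one, add_tsub_cancel_right,
    sub_add_cancel_right, ← Finset.sum_neg_distrib]
  refine Finset.sum_congr rfl fun i _ => ?_
  rw [add_comm 1 i, add_tsub_cancel_right]
  ring

theorem fPoly_eq {Fq : Type*} [Field Fq] (k : ℕ) :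
    fPoly Fq k = ∑ i ∈ Finset.range k, (1 - X) ^ i := by
  refine mul_left_cancel₀ (X_ne_zero : (X : Fq[X]) ≠ 0) ?_
  rw [X_mul_fPoly, FPoly]
  have := geom_sum_mul (1 - X : Fq[X]) k
  linear_combination this

/-! ### Identities relating `φ`, `λ`, `Q` and `Φ` -/

section Formulas

variable {Fq Ω : Type*} [Fintype Fq] [Field Ω]

local notation "q" => Fintype.card Fq

theorem gOf_eq (j k : ℕ) {x : Ω} (hx : x ≠ 0) :
    gOf Fq j k x = x ^ (q ^ (j + k)) / x ^ (q ^ j) - x / x ^ (q ^ j) := by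
  rw [gOf, zpow_sub₀ hx, zpow_sub₀ hx, zpow_one]
  norm_cast

variable (Fq) in
/-- The parameter of the quotient of `φ ^ x` by the kernel of `λ_x`. -/
def gNext (j k : ℕ) (x : Ω) : Ω := x ^ (q ^ k) / x - x ^ (q ^ k) / x ^ (q ^ (j + k))

variable [Field Fq] [Algebra Fq Ω]

theorem add_pow_card_pow (i : ℕ) (a b : Ω) : (a + b) ^ (q ^ i) = a ^ (q ^ i) + b ^ (q ^ i) := by
  simp only [← tau_pow_apply, map_add]

theorem sub_pow_card_pow (i : ℕ) (a b : Ω) : (a - b) ^ (q ^ i) = a ^ (q ^ i) - b ^ (q ^ i) := by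
  simp only [← tau_pow_apply, map_sub]

theorem neg_pow_card_pow (i : ℕ) (a : Ω) : (-a) ^ (q ^ i) = -a ^ (q ^ i) := by
  simp only [← tau_pow_apply, map_neg]

theorem sum_pow_card_pow {ι : Type*} (s : Finset ι) (a : ι → Ω) (i : ℕ) :
    (∑ l ∈ s, a l) ^ (q ^ i) = ∑ l ∈ s, a l ^ (q ^ i) := by
  simp only [← tau_pow_apply, map_sum]

theorem phiT_apply (j k : ℕ) (g z : Ω) :
    phiT Fq j k g z = -z ^ (q ^ (j + k)) + g * z ^ (q ^ j) + z := by
  simp [phiT, tau_pow_apply]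

theorem lam_apply (k : ℕ) {x : Ω} (hx : x ≠ 0) (z : Ω) :
    lam Fq k x z = x ^ (q ^ k) / x * z - z ^ (q ^ k) := by
  have h : x ^ ((q : ℤ) ^ k - 1) = x ^ (q ^ k) / x := by
    rw [zpow_sub₀ hx, zpow_one]
    norm_cast
  simp [lam, tau_pow_apply, h]

theorem Q_apply (j k : ℕ) {x : Ω} (hx : x ≠ 0) (y : Ω) :
    Q Fq j k x y = ∑ i ∈ Finset.range j, x / x ^ (q ^ (k + i)) * y ^ (q ^ i)
      + ∑ i ∈ Finset.range k, x / x ^ (q ^ i) * y ^ (q ^ (j + i)) := by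
  have h : ∀ i : ℕ, x ^ (1 - (q : ℤ) ^ i) = x / x ^ (q ^ i) := by
    intro i
    rw [zpow_sub₀ hx, zpow_one]
    norm_cast
  simp [Q, tau_pow_apply, h]

/-- `φ_T` preserves the kernel of `λ_x`, so it descends along `λ_x`; comparing coefficients of
powers of `τ` identifies the new parameter. -/
theorem lam_phiT (j k : ℕ) {x : Ω} (hx : x ≠ 0) (z : Ω) :
    lam Fq k x (phiT Fq j k (gOf Fq j k x) z)
      = phiT Fq j k (gNext Fq j k x) (lam Fq k x z) := by
  simp only [lam_apply k hx, phiT_apply, gOf_eq j k hx, gNext, add_pow_card_pow,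
    sub_pow_card_pow, neg_pow_card_pow, mul_pow, div_pow, ← pow_mul, ← pow_add]
  simp only [show j + k + k = k + (j + k) by ring, show k + j = j + k by ring]
  have h1 := pow_ne_zero (q ^ j) hx
  have h2 := pow_ne_zero (q ^ k) hx
  have h3 := pow_ne_zero (q ^ (j + k)) hx
  have h4 := pow_ne_zero (q ^ (k + (j + k))) hx
  generalize x ^ (q ^ j) = x1 at *
  generalize x ^ (q ^ k) = x2 at *
  generalize x ^ (q ^ (j + k)) = x3 at *
  generalize x ^ (q ^ (k + (j + k))) = x4 at *
  field_simp
  ring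

/-- `Q_x(y) / x` is the sum of the first `j` Frobenius iterates of `y / x ^ (q ^ k)` and the first
`k` iterates of `y ^ (q ^ j) / x`, so `τ - 1` telescopes to four boundary terms. -/
theorem Q_div_pow_sub (j k : ℕ) {x : Ω} (hx : x ≠ 0) (y : Ω) :
    (Q Fq j k x y / x) ^ q - Q Fq j k x y / x
      = -(phiT Fq j k (gNext Fq j k x) y / x ^ (q ^ k)) := by
  have h : Q Fq j k x y / x = ∑ i ∈ Finset.range j, y ^ (q ^ i) / x ^ (q ^ (k + i))
      + ∑ i ∈ Finset.range k, y ^ (q ^ (j + i)) / x ^ (q ^ i) := by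
    rw [Q_apply j k hx, add_div, Finset.sum_div, Finset.sum_div]
    congr 1 <;> refine Finset.sum_congr rfl fun i _ => ?_ <;> field_simp
  have h' : (Q Fq j k x y / x) ^ q
      = ∑ i ∈ Finset.range j, y ^ (q ^ (i + 1)) / x ^ (q ^ (k + (i + 1)))
      + ∑ i ∈ Finset.range k, y ^ (q ^ (j + (i + 1))) / x ^ (q ^ (i + 1)) := by
    have e : ∀ a : Ω, a ^ q = a ^ (q ^ 1) := by simp
    rw [h, e, add_pow_card_pow, sum_pow_card_pow, sum_pow_card_pow]
    simp only [div_pow, ← pow_mul, ← pow_add, add_assoc]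
  have s1 := Finset.sum_range_sub (fun i => y ^ (q ^ i) / x ^ (q ^ (k + i))) j
  have s2 := Finset.sum_range_sub (fun i => y ^ (q ^ (j + i)) / x ^ (q ^ i)) k
  rw [Finset.sum_sub_distrib] at s1 s2
  rw [h', h, phiT_apply, gNext]
  have h1 := pow_ne_zero (q ^ k) hx
  have h3 := pow_ne_zero (q ^ (j + k)) hx
  simp only [add_comm k j, pow_zero, pow_one, add_zero] at s1 s2
  rw [add_sub_add_comm, s1, s2]
  field_simp
  ring

theorem phiT_eq_zero_of_Q_eq (j k : ℕ) {x : Ω} (hx : x ≠ 0) {y : Ω} (h : Q Fq j k x y = x) :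
    phiT Fq j k (gNext Fq j k x) y = 0 := by
  have := Q_div_pow_sub j k hx y (Fq := Fq)
  rw [h, div_self hx, one_pow, sub_self, eq_comm, neg_eq_zero, div_eq_zero_iff] at this
  exact this.resolve_right (pow_ne_zero _ hx)

theorem eq_gOf (j k : ℕ) {g y : Ω} (hy : y ≠ 0) (h : phiT Fq j k g y = 0) :
    g = gOf Fq j k y := by
  rw [phiT_apply] at h
  rw [gOf_eq j k hy, ← sub_div, eq_div_iff (pow_ne_zero _ hy)]
  linear_combination h

theorem phiT_gOf_self (j k : ℕ) {x : Ω} (hx : x ≠ 0) :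
    phiT Fq j k (gOf Fq j k x) x = 0 := by
  rw [phiT_apply, gOf_eq j k hx]
  have := pow_ne_zero (q ^ j) hx
  field_simp
  ring

theorem ne_zero_of_Q_eq (j k : ℕ) {x : Ω} (hx : x ≠ 0) {y : Ω} (h : Q Fq j k x y = x) :
    y ≠ 0 := by
  rintro rfl
  exact hx (by rw [← h, map_zero])

theorem gNext_eq_gOf (j k : ℕ) {x : Ω} (hx : x ≠ 0) {y : Ω} (h : Q Fq j k x y = x) :
    gNext Fq j k x = gOf Fq j k y :=
  eq_gOf j k (ne_zero_of_Q_eq j k hx h) (phiT_eq_zero_of_Q_eq j k hx h)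

/-- With `z = x v`, the terms containing powers of `x` agree one by one. The rest is `e3`: two ways
of splitting the sum of the first `j + k` Frobenius iterates of `v`. -/
theorem Q_lam (j k : ℕ) {x : Ω} (hx : x ≠ 0) (z : Ω) :
    Q Fq j k x (lam Fq k x z)
      = (∑ i ∈ Finset.range k, (phiT Fq j k (gOf Fq j k x) z / x) ^ (q ^ i)) * x := by
  obtain ⟨v, rfl⟩ : ∃ v, z = x * v := ⟨z / x, by field_simp⟩
  have hl : lam Fq k x (x * v) = x ^ (q ^ k) * (v - v ^ (q ^ k)) := by
    rw [lam_apply k hx, mul_pow]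
    field_simp
  have hp : phiT Fq j k (gOf Fq j k x) (x * v) / x
      = v - v ^ (q ^ j) + x ^ (q ^ (j + k)) / x * (v ^ (q ^ j) - v ^ (q ^ (j + k))) := by
    rw [phiT_apply, gOf_eq j k hx, mul_pow, mul_pow]
    have := pow_ne_zero (q ^ j) hx
    field_simp
    ring
  have e1 : ∑ i ∈ Finset.range j,
        x / x ^ (q ^ (k + i)) * (x ^ (q ^ k) * (v - v ^ (q ^ k))) ^ (q ^ i)
      = (∑ i ∈ Finset.range j, v ^ (q ^ i) - ∑ i ∈ Finset.range j, v ^ (q ^ (k + i))) * x := by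
    rw [← Finset.sum_sub_distrib, Finset.sum_mul]
    refine Finset.sum_congr rfl fun i _ => ?_
    rw [mul_pow, sub_pow_card_pow, ← pow_mul, ← pow_mul, ← pow_add]
    have := pow_ne_zero (q ^ (k + i)) hx
    field_simp
  have e2 : ∑ i ∈ Finset.range k,
        x / x ^ (q ^ i) * (x ^ (q ^ k) * (v - v ^ (q ^ k))) ^ (q ^ (j + i))
      = (∑ i ∈ Finset.range k,
          (x ^ (q ^ (j + k)) / x * (v ^ (q ^ j) - v ^ (q ^ (j + k)))) ^ (q ^ i)) * x := by
    rw [Finset.sum_mul]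
    refine Finset.sum_congr rfl fun i _ => ?_
    simp only [mul_pow, div_pow, sub_pow_card_pow, ← pow_mul, ← pow_add]
    have := pow_ne_zero (q ^ i) hx
    rw [show k + (j + i) = j + k + i by ring]
    field_simp
  have e3 : ∑ i ∈ Finset.range j, v ^ (q ^ i) + ∑ i ∈ Finset.range k, v ^ (q ^ (j + i))
      = ∑ i ∈ Finset.range k, v ^ (q ^ i) + ∑ i ∈ Finset.range j, v ^ (q ^ (k + i)) := by
    rw [← Finset.sum_range_add, ← Finset.sum_range_add, add_comm]
  rw [Q_apply j k hx, hl, hp, e1, e2, ← add_mul]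
  congr 1
  simp only [add_pow_card_pow, Finset.sum_add_distrib, sub_pow_card_pow, Finset.sum_sub_distrib,
    ← pow_mul v, ← pow_add q]
  linear_combination e3

theorem lam_eq_zero_iff (k : ℕ) {x : Ω} (hx : x ≠ 0) (z : Ω) :
    lam Fq k x z = 0 ↔ ∃ μ : Fqk Fq Ω k, z = μ • x := by
  rw [lam_apply k hx]
  constructor
  · intro h
    refine ⟨⟨z / x, (mem_Fqk Fq k _).2 ?_⟩, ?_⟩
    · have := pow_ne_zero (q ^ k) hx
      rw [div_pow, ← sub_eq_zero.1 h]
      field_simp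
    · rw [Subfield.smul_def, smul_eq_mul]
      field_simp
  · rintro ⟨μ, rfl⟩
    have := (mem_Fqk Fq k (μ : Ω)).1 μ.2
    rw [Subfield.smul_def, smul_eq_mul, mul_pow, this]
    field_simp
    ring

theorem lam_smul (k : ℕ) (x : Ω) (μ : Fqk Fq Ω k) (z : Ω) :
    lam Fq k x (μ • z) = μ • lam Fq k x z := by
  have := (mem_Fqk Fq k (μ : Ω)).1 μ.2
  simp only [lam, LinearMap.sub_apply, LinearMap.smul_apply, Module.End.one_apply, tau_pow_apply,
    Subfield.smul_def, smul_eq_mul, mul_pow, this]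
  ring

theorem lamProd_smul (k : ℕ) (x : ℕ → Ω) (l : ℕ) (μ : Fqk Fq Ω k) (z : Ω) :
    lamProd Fq k x l (μ • z) = μ • lamProd Fq k x l z := by
  induction l with
  | zero => rfl
  | succ l ih => rw [lamProd, Module.End.mul_apply, ih, lam_smul, Module.End.mul_apply]

theorem pow_card_pow_mod (k : ℕ) {μ : Ω} (hμ : μ ∈ Fqk Fq Ω k) (s : ℕ) :
    μ ^ (q ^ s) = μ ^ (q ^ (s % k)) := by
  have h : ∀ l, μ ^ (q ^ (k * l)) = μ := by
    intro l
    induction l with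
    | zero => simp
    | succ l ih => rw [mul_add_one, pow_add, pow_mul, ih, (mem_Fqk Fq k μ).1 hμ]
  conv_lhs => rw [← Nat.div_add_mod s k, pow_add, pow_mul, h]

/-- Since `j` is invertible modulo `k`, multiplication by `j` permutes the residues, hence the
conjugates of `μ`. -/
theorem sum_pow_card_pow_mul (j k : ℕ) (hk : 1 ≤ k) (hjk : Nat.Coprime j k) {μ : Ω}
    (hμ : μ ∈ Fqk Fq Ω k) :
    ∑ i ∈ Finset.range k, μ ^ (q ^ (j * i)) = ∑ i ∈ Finset.range k, μ ^ (q ^ i) := by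
  have hinj : Set.InjOn (fun i => j * i % k) (Finset.range k : Set ℕ) := by
    intro a ha b hb hab
    have : a ≡ b [MOD k] := Nat.ModEq.cancel_left_of_coprime (by rwa [Nat.gcd_comm]) hab
    simp only [Finset.coe_range, Set.mem_Iio] at ha hb
    rwa [Nat.ModEq, Nat.mod_eq_of_lt ha, Nat.mod_eq_of_lt hb] at this
  have himg : (Finset.range k).image (fun i => j * i % k) = Finset.range k := by
    refine Finset.eq_of_subset_of_card_le ?_ ?_
    · intro a ha
      obtain ⟨i, -, rfl⟩ := Finset.mem_image.1 ha
      exact Finset.mem_range.2 (Nat.mod_lt _ hk)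
    · rw [Finset.card_image_of_injOn hinj]
  conv_rhs => rw [← himg, Finset.sum_image hinj]
  exact Finset.sum_congr rfl fun i _ => pow_card_pow_mod k hμ _

theorem one_sub_phiT_pow_smul (j k : ℕ) {x : Ω} (hx : x ≠ 0) (μ : Fqk Fq Ω k) (l : ℕ) :
    ((1 - phiT Fq j k (gOf Fq j k x)) ^ l) (μ • x) = ((μ : Ω) ^ (q ^ (j * l))) * x := by
  rw [Subfield.smul_def, smul_eq_mul, one_sub_phiT_pow_mul Fq j k _ _ μ.2]
  congr 1
  induction l with
  | zero => rfl
  | succ l ih =>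
    rw [pow_succ, Module.End.mul_apply, LinearMap.sub_apply, phiT_gOf_self j k hx, sub_zero,
      Module.End.one_apply, ih]

/-- As `f = ∑ (1 - T) ^ i` over `i < k`, and `1 - φ_T` acts on the line through `x` as the generator
`τ ^ j` of the Galois group, `φ_f` acts there as the trace. -/
theorem phi_fPoly_smul (j k : ℕ) (hk : 1 ≤ k) (hjk : Nat.Coprime j k) {x : Ω} (hx : x ≠ 0)
    (μ : Fqk Fq Ω k) :
    phi Fq j k (gOf Fq j k x) (fPoly Fq k) (μ • x)
      = (∑ i ∈ Finset.range k, (μ : Ω) ^ (q ^ i)) * x := by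
  rw [fPoly_eq, map_sum, LinearMap.sum_apply, ← sum_pow_card_pow_mul j k hk hjk μ.2,
    Finset.sum_mul]
  refine Finset.sum_congr rfl fun i _ => ?_
  rw [← one_sub_phiT_pow_smul j k hx]
  simp [phi]

theorem phi_FPoly_eq (j k : ℕ) (g z : Ω) : phi Fq j k g (FPoly Fq k) z
    = phi Fq j k g (fPoly Fq k) (phiT Fq j k g z) := by
  rw [← X_mul_fPoly, mul_comm, map_mul, Module.End.mul_apply]
  simp [phi]

theorem PhiTk_eq_Q_lam (j k : ℕ) (hk : 1 ≤ k) (hjk : Nat.Coprime j k) {x : Ω} (hx : x ≠ 0)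
    {z : Ω} (h : lam Fq k x (phiT Fq j k (gOf Fq j k x) z) = 0) :
    PhiTk Fq j k (gOf Fq j k x) z = Q Fq j k x (lam Fq k x z) := by
  obtain ⟨μ, hμ⟩ := (lam_eq_zero_iff k hx _).1 h
  change phi Fq j k (gOf Fq j k x) (FPoly Fq k) z = _
  rw [phi_FPoly_eq, hμ, phi_fPoly_smul j k hk hjk hx, Q_lam j k hx, hμ, Subfield.smul_def,
    smul_eq_mul, mul_div_cancel_right₀ _ hx]

theorem PhiTk_self (j k : ℕ) {x : Ω} (hx : x ≠ 0) :
    PhiTk Fq j k (gOf Fq j k x) x = 0 := by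
  change phi Fq j k (gOf Fq j k x) (FPoly Fq k) x = _
  rw [phi_FPoly_eq, phiT_gOf_self j k hx, map_zero]

theorem Phi_X_pow_apply (j k n : ℕ) (g z : Ω) :
    Phi Fq j k g (X ^ n) z = (PhiTk Fq j k g ^ n) z := by
  rw [Phi, map_pow, aeval_X]
  induction n with
  | zero => rfl
  | succ n ih => rw [pow_succ', pow_succ', Module.End.mul_apply, Module.End.mul_apply, ih]; rfl

end Formulas

/-! ### Cyclic modules over a polynomial ring -/

section CyclicModules

variable {R V : Type*} [CommRing R] [AddCommGroup V] [Module R V]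

/-- Replaces an abstract isomorphism by a generator with prescribed annihilator, the image of `1`.
-/
theorem isSubmoduleIsoQuot_iff (t : Module.End R V) (E : Set V) (a : R[X]) :
    IsSubmoduleIsoQuot t E a ↔
      ∃ e : V, (∀ z, z ∈ E ↔ ∃ b : R[X], aeval t b e = z) ∧
        ∀ b : R[X], aeval t b e = 0 ↔ a ∣ b := by
  constructor
  · rintro ⟨N, hN, ⟨φ⟩⟩
    set e := φ.symm (Ideal.Quotient.mk _ 1) with he
    have key : ∀ b : R[X], φ.symm (Ideal.Quotient.mk _ b) = b • e := by
      intro b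
      rw [he, ← map_smul]
      exact congrArg (fun c => φ.symm (Ideal.Quotient.mk _ c)) (mul_one b).symm
    have key' : ∀ b : R[X], ((b • e : N) : Module.AEval' t)
        = Module.AEval'.of t (aeval t b ((Module.AEval'.of t).symm e)) := fun b => rfl
    refine ⟨(Module.AEval'.of t).symm e, fun z => ?_, fun b => ?_⟩
    · rw [← hN]
      constructor
      · intro hz
        obtain ⟨b, hb⟩ := Ideal.Quotient.mk_surjective (φ ⟨_, hz⟩)
        refine ⟨b, (Module.AEval'.of t).injective ?_⟩
        rw [← key', ← key, hb, φ.symm_apply_apply]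
      · rintro ⟨b, rfl⟩
        rw [← key']
        exact (b • e).2
    · rw [← (Module.AEval'.of t).map_eq_zero_iff, ← key', ZeroMemClass.coe_eq_zero, ← key,
        φ.symm.map_eq_zero_iff, Ideal.Quotient.eq_zero_iff_mem, Ideal.mem_span_singleton]
  · rintro ⟨e, h1, h2⟩
    refine ⟨Submodule.span R[X] {Module.AEval'.of t e}, fun z => ?_, ⟨?_⟩⟩
    · rw [h1, Submodule.mem_span_singleton]
      refine exists_congr fun b => ?_
      rw [← (Module.AEval'.of t).injective.eq_iff]
      rfl
    · refine ((Submodule.quotEquivOfEq _ _ ?_).trans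
        (Ideal.quotTorsionOfEquivSpanSingleton R[X] _ (Module.AEval'.of t e))).symm
      ext b
      rw [Ideal.mem_span_singleton, ← h2, Ideal.mem_torsionOf_iff,
        ← (Module.AEval'.of t).map_eq_zero_iff]
      rfl

theorem pow_dvd_of_aeval_eq_zero (t : Module.End R V) (a : R[X]) (e : V) (n : ℕ)
    (h : ∀ b : R[X], aeval t b (aeval t (a ^ (n - 1)) e) = 0 → a ∣ b) (b : R[X])
    (hb : aeval t b e = 0) : a ^ n ∣ b := by
  suffices ∀ i ≤ n, a ^ i ∣ b from this n le_rfl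
  intro i
  induction i with
  | zero => simp
  | succ i ih =>
    intro hi
    obtain ⟨c, rfl⟩ := ih (by omega)
    rw [pow_succ]
    refine mul_dvd_mul_left _ (h c ?_)
    -- If `a ^ i * c` kills `e`, then so does `c * a ^ (n - 1)`; thus `c` kills `a ^ (n - 1) e`.
    rw [← Module.End.mul_apply, ← map_mul,
      show c * a ^ (n - 1) = a ^ (n - 1 - i) * (a ^ i * c) by
        rw [show n - 1 = n - 1 - i + i by omega, pow_add]; simp; ring,
      map_mul, Module.End.mul_apply, hb, map_zero]

theorem aeval_apply_of_apply_eq_zero (t : Module.End R V) (z : V) (h : t z = 0) (b : R[X]) :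
    aeval t b z = b.coeff 0 • z := by
  rw [aeval_endomorphism, Polynomial.sum_over_range _ (by simp), Finset.sum_range_succ']
  simp [pow_succ, h]

end CyclicModules

/-! ### Root counts, normal bases and traces -/

section FiniteFields

theorem card_zeros_of_derivative {Ω : Type*} [Field Ω] [IsAlgClosed Ω] (p : Polynomial Ω) (a : Ω)
    (ha : a ≠ 0) (hp : derivative p = C a) : Nat.card {y : Ω // p.eval y = 0} = p.natDegree := by
  have hs : p.Separable := by
    rw [Polynomial.separable_def, hp]
    exact ⟨0, C a⁻¹, by rw [← C_mul, inv_mul_cancel₀ ha]; simp⟩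
  rw [← Polynomial.card_rootSet_eq_natDegree (K := Ω) hs (IsAlgClosed.splits _),
    ← Nat.card_eq_fintype_card]
  refine Nat.card_congr (Equiv.subtypeEquivRight fun y => ?_)
  rw [mem_rootSet_of_ne hs.ne_zero, coe_aeval_eq_eval]

/-- The conjugates are listed by powers of `τ ^ j`, the order in which the powers of `1 - φ_T`
produce them. -/
theorem exists_normal_element (K L : Type*) [Field K] [Fintype K] [Field L] [Finite L] [Algebra K L]
    (j k : ℕ) (hjk : Nat.Coprime j k) (hk : Module.finrank K L = k) :
    ∃ θ : L, (∀ c : Fin k → K, ∑ i, c i • θ ^ (Fintype.card K ^ (j * i)) = 0 → c = 0) ∧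
      ∀ μ : L, ∃ c : Fin k → K, ∑ i, c i • θ ^ (Fintype.card K ^ (j * i)) = μ := by
  obtain ⟨θ, hθ⟩ : ∃ θ : L, LinearIndependent K fun σ : L ≃ₐ[K] L => σ θ :=
    ⟨IsGalois.normalBasis K L 1, by
      simpa only [← IsGalois.normalBasis_apply] using (IsGalois.normalBasis K L).linearIndependent⟩
  set F := FiniteField.frobeniusAlgEquivOfAlgebraic K L
  have hinj : Function.Injective (fun i : Fin k => F ^ (j * i : ℕ)) := by
    intro a b hab
    have h : j * a ≡ j * b [MOD k] := by
      have := pow_eq_pow_iff_modEq.1 hab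
      rwa [FiniteField.orderOf_frobeniusAlgEquivOfAlgebraic, hk] at this
    have := Nat.ModEq.cancel_left_of_coprime (by rwa [Nat.gcd_comm]) h
    rw [Nat.ModEq, Nat.mod_eq_of_lt a.2, Nat.mod_eq_of_lt b.2] at this
    exact Fin.ext this
  have hli := hθ.comp _ hinj
  have heq : ((fun σ : L ≃ₐ[K] L => σ θ) ∘ fun i : Fin k => F ^ (j * i : ℕ))
      = fun i : Fin k => θ ^ (Fintype.card K ^ (j * i : ℕ)) := by
    funext i
    have := congrFun (FiniteField.coe_frobeniusAlgEquivOfAlgebraic_iterate K L (j * i)) θ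
    rw [← this, Function.comp_apply, AlgEquiv.coe_pow]
  rw [heq] at hli
  refine ⟨θ, fun c hc => funext (Fintype.linearIndependent_iff.1 hli c hc), fun μ => ?_⟩
  have hs := hli.span_eq_top_of_card_eq_finrank' (by simp [hk])
  have hμ : μ ∈ Submodule.span K (Set.range fun i : Fin k => θ ^ (Fintype.card K ^ (j * i : ℕ))) :=
    hs ▸ Submodule.mem_top
  exact (Submodule.mem_span_range_iff_exists_fun K).1 hμ

variable (Fq : Type*) {Ω : Type*} [Field Fq] [Fintype Fq] [Field Ω] [Algebra Fq Ω]

theorem cast_card_eq_zero : ((Fintype.card Fq : ℕ) : Ω) = 0 := by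
  rw [← map_natCast (algebraMap Fq Ω), FiniteField.cast_card_eq_zero, map_zero]

variable [IsAlgClosed Ω]

theorem card_zeros_additive (s : ℕ) (a : ℕ → Ω) (c : Ω) (h0 : a 0 ≠ 0) (hs : a s ≠ 0) :
    Nat.card {y : Ω // ∑ i ∈ Finset.range (s + 1), a i * y ^ (Fintype.card Fq ^ i) = c}
      = Fintype.card Fq ^ s := by
  have hq := cast_card_eq_zero Fq (Ω := Ω)
  set p : Polynomial Ω :=
    ∑ i ∈ Finset.range (s + 1), C (a i) * X ^ (Fintype.card Fq ^ i) - C c with hp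
  have hder : derivative p = C (a 0) := by
    rw [hp, Finset.sum_range_succ']
    simp [derivative_X_pow, hq]
  have hdeg : p.natDegree = Fintype.card Fq ^ s := by
    have hr : (∑ i ∈ Finset.range s, C (a i) * X ^ (Fintype.card Fq ^ i) - C c).degree
        < ((Fintype.card Fq ^ s : ℕ) : WithBot ℕ) := by
      rw [← mem_degreeLT]
      refine Submodule.sub_mem _ (Submodule.sum_mem _ fun i hi => ?_) ?_
      · rw [mem_degreeLT]
        refine (degree_C_mul_X_pow_le _ _).trans_lt ?_
        exact_mod_cast Nat.pow_lt_pow_right Fintype.one_lt_card (Finset.mem_range.1 hi)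
      · rw [mem_degreeLT]
        refine degree_C_le.trans_lt ?_
        exact_mod_cast pow_pos Fintype.card_pos s
    have hp' : p = C (a s) * X ^ (Fintype.card Fq ^ s)
        + (∑ i ∈ Finset.range s, C (a i) * X ^ (Fintype.card Fq ^ i) - C c) := by
      rw [hp, Finset.sum_range_succ]
      ring
    refine natDegree_eq_of_degree_eq_some ?_
    rw [hp', degree_add_eq_left_of_degree_lt, degree_C_mul_X_pow _ hs]
    rwa [degree_C_mul_X_pow _ hs]
  rw [← hdeg, ← card_zeros_of_derivative p (a 0) h0 hder]
  refine Nat.card_congr (Equiv.subtypeEquivRight fun y => ?_)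
  rw [hp]
  simp [eval_finsetSum, sub_eq_zero]

theorem card_Fqk (k : ℕ) (hk : 1 ≤ k) : Nat.card (Fqk Fq Ω k) = Fintype.card Fq ^ k := by
  have hq := cast_card_eq_zero Fq (Ω := Ω)
  have h1 : 1 < Fintype.card Fq ^ k := Nat.one_lt_pow (by omega) Fintype.one_lt_card
  have := card_zeros_of_derivative (X ^ (Fintype.card Fq ^ k) - X : Polynomial Ω) (-1) (by simp)
    (by simp [derivative_X_pow, hq, show k ≠ 0 by omega])
  rw [FiniteField.X_pow_card_sub_X_natDegree_eq _ h1] at this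
  rw [← this]
  refine Nat.card_congr (Equiv.subtypeEquivRight fun y => ?_)
  rw [mem_Fqk]
  simp [sub_eq_zero]

theorem exists_normal_element_Fqk (j k : ℕ) (hjk : Nat.Coprime j k) (hk : 1 ≤ k) :
    ∃ θ ∈ Fqk Fq Ω k,
      (∀ c : ℕ → Fq, ∑ i ∈ Finset.range k, c i • θ ^ (Fintype.card Fq ^ (j * i)) = 0 →
        ∀ i < k, c i = 0) ∧
      ∀ μ ∈ Fqk Fq Ω k, ∃ c : ℕ → Fq,
        ∑ i ∈ Finset.range k, c i • θ ^ (Fintype.card Fq ^ (j * i)) = μ := by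
  let _ : Algebra Fq (Fqk Fq Ω k) := ((algebraMap Fq Ω).codRestrict (Fqk Fq Ω k) fun a => by
    rw [mem_Fqk, ← map_pow, FiniteField.pow_card_pow]).toAlgebra
  have hsmul : ∀ (c : Fq) (z : Fqk Fq Ω k), ((c • z : Fqk Fq Ω k) : Ω) = c • (z : Ω) := by
    intro c z
    rw [Algebra.smul_def, Algebra.smul_def]
    rfl
  have hcard := card_Fqk Fq (Ω := Ω) k hk
  have : Finite (Fqk Fq Ω k) := Nat.finite_of_card_ne_zero (by rw [hcard]; simp)
  have hfin : Module.finrank Fq (Fqk Fq Ω k) = k := by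
    have h := Module.natCard_eq_pow_finrank (K := Fq) (V := Fqk Fq Ω k)
    rw [hcard, Nat.card_eq_fintype_card] at h
    exact (Nat.pow_right_injective (Fintype.one_lt_card (α := Fq)) h).symm
  obtain ⟨θ, h1, h2⟩ := exists_normal_element Fq (Fqk Fq Ω k) j k hjk hfin
  have hsum : ∀ c : ℕ → Fq, ((∑ i : Fin k, c i • θ ^ (Fintype.card Fq ^ (j * i : ℕ)) :
      Fqk Fq Ω k) : Ω)
      = ∑ i ∈ Finset.range k, c i • (θ : Ω) ^ (Fintype.card Fq ^ (j * i)) := by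
    intro c
    rw [← Fin.sum_univ_eq_sum_range (fun i => c i • (θ : Ω) ^ (Fintype.card Fq ^ (j * i)))]
    simp [hsmul]
  refine ⟨θ, θ.2, fun c hc i hi => ?_, fun μ hμ => ?_⟩
  · rw [← hsum, ZeroMemClass.coe_eq_zero] at hc
    exact congrFun (h1 (fun i => c i) hc) ⟨i, hi⟩
  · obtain ⟨c, hc⟩ := h2 ⟨μ, hμ⟩
    refine ⟨fun i => if h : i < k then c ⟨i, h⟩ else 0, ?_⟩
    rw [← hsum]
    simp [hc]

theorem exists_trace_one (k : ℕ) (hk : 1 ≤ k) :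
    ∃ μ ∈ Fqk Fq Ω k, ∑ i ∈ Finset.range k, μ ^ (Fintype.card Fq ^ i) = 1 := by
  obtain ⟨l, rfl⟩ : ∃ l, k = l + 1 := ⟨k - 1, by omega⟩
  have hcard := card_zeros_additive Fq (Ω := Ω) l 1 1 (by simp) (by simp)
  obtain ⟨⟨μ, hμ⟩⟩ := (Nat.card_pos_iff.1 (hcard ▸ pow_pos Fintype.card_pos l)).1
  have hμ1 : ∑ i ∈ Finset.range (l + 1), μ ^ (Fintype.card Fq ^ i) = 1 := by
    simpa using hμ
  refine ⟨μ, ?_, hμ1⟩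
  -- Every root lies in the subfield: raising the equation to the power `q` and subtracting
  -- telescopes to `μ ^ (q ^ k) = μ`.
  have h2 := congrArg (· ^ Fintype.card Fq ^ 1) hμ1
  simp only [sum_pow_card_pow, one_pow, ← pow_mul, ← pow_add] at h2
  have h3 := Finset.sum_range_sub (fun i => μ ^ (Fintype.card Fq ^ i)) (l + 1)
  rw [Finset.sum_sub_distrib, h2, hμ1, sub_self, eq_comm, sub_eq_zero] at h3
  rw [mem_Fqk, h3, pow_zero, pow_one]

end FiniteFields

/-! ### Marked level structures through one generator -/

section Good

variable {Fq Ω : Type*} [Field Fq] [Fintype Fq] [Field Ω] [Algebra Fq Ω]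

theorem PhiTk_pow_apply (j k n : ℕ) (g z : Ω) :
    (PhiTk Fq j k g ^ n) z = phi Fq j k g (FPoly Fq k ^ n) z := by
  induction n with
  | zero => simp
  | succ n ih => rw [pow_succ', pow_succ', Module.End.mul_apply, ih, map_mul]; rfl

theorem aeval_PhiTk_X_pow (j k n : ℕ) (g z : Ω) :
    aeval (PhiTk Fq j k g) (X ^ n : (Fqk Fq Ω k)[X]) z = (PhiTk Fq j k g ^ n) z := by
  rw [map_pow, aeval_X]

theorem PhiTk_pow_phi (j k n : ℕ) (g z : Ω) (b : Fq[X]) :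
    (PhiTk Fq j k g ^ n) (phi Fq j k g b z) = phi Fq j k g b ((PhiTk Fq j k g ^ n) z) := by
  rw [PhiTk_pow_apply, PhiTk_pow_apply, ← Module.End.mul_apply, ← Module.End.mul_apply,
    ← map_mul, ← map_mul, mul_comm]

theorem phiT_eq_phi_X (j k : ℕ) (g : Ω) : phiT Fq j k g = phi Fq j k g X := by
  simp [phi]

theorem PhiTk_pow_aeval (j k n : ℕ) (g z : Ω) (d : (Fqk Fq Ω k)[X]) :
    (PhiTk Fq j k g ^ n) (aeval (PhiTk Fq j k g) d z)
      = aeval (PhiTk Fq j k g) d ((PhiTk Fq j k g ^ n) z) := by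
  rw [← aeval_PhiTk_X_pow, ← aeval_PhiTk_X_pow, ← Module.End.mul_apply, ← Module.End.mul_apply,
    ← map_mul, ← map_mul, mul_comm]

variable (Fq) in
/-- A description of the members of `markedLevelSet` that only involves one generator over the
polynomial ring in `Φ_T` and the stability under `φ_T`. -/
def IsMarked (j k n : ℕ) (x : Ω) (E : Submodule (Fqk Fq Ω k) Ω) : Prop :=
  (∀ z ∈ E, phiT Fq j k (gOf Fq j k x) z ∈ E) ∧
    ∃ h : Ω, (PhiTk Fq j k (gOf Fq j k x) ^ (n - 1)) h = x ∧
      ∀ z, z ∈ E ↔ ∃ d : (Fqk Fq Ω k)[X], aeval (PhiTk Fq j k (gOf Fq j k x)) d h = z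

/-- The nonzero element `x = Φ_T ^ (n - 1) h` is killed by `Φ_T`, so a polynomial kills it only if
its constant term vanishes. -/
theorem X_pow_dvd_of_aeval_eq_zero (j k n : ℕ) {x h : Ω} (hx : x ≠ 0)
    (hh : (PhiTk Fq j k (gOf Fq j k x) ^ (n - 1)) h = x) (d : (Fqk Fq Ω k)[X])
    (hd : aeval (PhiTk Fq j k (gOf Fq j k x)) d h = 0) : X ^ n ∣ d := by
  refine pow_dvd_of_aeval_eq_zero _ X h n (fun b hb => ?_) d hd
  rw [aeval_PhiTk_X_pow, hh, aeval_apply_of_apply_eq_zero _ _ (PhiTk_self j k hx),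
    smul_eq_zero] at hb
  exact X_dvd_iff.2 (hb.resolve_right hx)

theorem PhiTk_pow_generator (j k n : ℕ) (hn : 1 ≤ n) {x h : Ω} (hx : x ≠ 0)
    (hh : (PhiTk Fq j k (gOf Fq j k x) ^ (n - 1)) h = x) :
    (PhiTk Fq j k (gOf Fq j k x) ^ n) h = 0 := by
  obtain ⟨n, rfl⟩ : ∃ l, n = l + 1 := ⟨n - 1, by omega⟩
  rw [add_tsub_cancel_right] at hh
  rw [pow_succ', Module.End.mul_apply, hh, PhiTk_self j k hx]

theorem exists_eq_aeval_of_pow_eq_zero (j k n : ℕ) {x h : Ω} (hx : x ≠ 0)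
    (hh : (PhiTk Fq j k (gOf Fq j k x) ^ (n - 1)) h = x) (i : ℕ) (hi : i ≤ n)
    (d : (Fqk Fq Ω k)[X])
    (hd : (PhiTk Fq j k (gOf Fq j k x) ^ i) (aeval (PhiTk Fq j k (gOf Fq j k x)) d h) = 0) :
    ∃ d' : (Fqk Fq Ω k)[X], aeval (PhiTk Fq j k (gOf Fq j k x)) d h
      = aeval (PhiTk Fq j k (gOf Fq j k x)) d' ((PhiTk Fq j k (gOf Fq j k x) ^ (n - i)) h) := by
  rw [← aeval_PhiTk_X_pow, ← Module.End.mul_apply, ← map_mul] at hd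
  have := X_pow_dvd_of_aeval_eq_zero j k n hx hh _ hd
  rw [show n = i + (n - i) by omega, pow_add] at this
  obtain ⟨d', rfl⟩ := (mul_dvd_mul_iff_left (pow_ne_zero i X_ne_zero)).1 this
  refine ⟨d', ?_⟩
  rw [mul_comm, map_mul, Module.End.mul_apply, aeval_PhiTk_X_pow]

theorem isMarked_of_mem_markedLevelSet (j k n : ℕ) {x : Ω} (hx : x ≠ 0) (hn : 1 ≤ n)
    {E : Submodule (Fqk Fq Ω k) Ω} (hE : E ∈ markedLevelSet Fq j k n x) :
    IsMarked Fq j k n x E := by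
  obtain ⟨⟨-, hA, hAk⟩, z, hz, hzx⟩ := hE
  obtain ⟨e, he, -⟩ := (isSubmoduleIsoQuot_iff _ _ _).1 hA
  obtain ⟨e', he', hann⟩ := (isSubmoduleIsoQuot_iff _ _ _).1 hAk
  have hstab : ∀ b : Fq[X], ∀ z ∈ E, phi Fq j k (gOf Fq j k x) b z ∈ E := by
    intro b z hz
    obtain ⟨c, rfl⟩ := (he z).1 hz
    exact (he _).2 ⟨b * c, by rw [map_mul]; rfl⟩
  refine ⟨fun z hz => by rw [phiT_eq_phi_X]; exact hstab _ z hz,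
    phi Fq j k (gOf Fq j k x) (fPoly Fq k) z, by rw [← Phi_X_pow_apply, hzx], ?_⟩
  obtain ⟨b, hb⟩ := (he' _).1 (hstab (fPoly Fq k) z hz)
  rw [Phi_X_pow_apply, ← hb, ← aeval_PhiTk_X_pow, ← Module.End.mul_apply, ← map_mul] at hzx
  -- A zero constant term would make `T ^ (n - 1) b` kill `e'`, forcing `x = 0`. So `b` is a unit
  -- modulo `T ^ n`, and `b e'` generates as well as `e'`.
  have hb0 : b.coeff 0 ≠ 0 := by
    intro h0
    obtain ⟨c, rfl⟩ := X_dvd_iff.2 h0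
    refine hx (hzx.symm.trans ((hann _).2 ⟨c, ?_⟩))
    rw [← mul_assoc, ← pow_succ, Nat.sub_add_cancel hn]
  obtain ⟨u, v, huv⟩ : IsCoprime b (X ^ n) :=
    IsCoprime.pow_right ((irreducible_X.coprime_iff_not_dvd.2 fun h => hb0 (X_dvd_iff.1 h)).symm)
  have hu : aeval (PhiTk Fq j k (gOf Fq j k x)) u (aeval (PhiTk Fq j k (gOf Fq j k x)) b e')
      = e' := by
    have := congrArg (fun c => aeval (PhiTk Fq j k (gOf Fq j k x)) c e') huv
    simp only [map_add, map_mul, LinearMap.add_apply, Module.End.mul_apply, map_one,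
      Module.End.one_apply, (hann (X ^ n)).2 dvd_rfl, map_zero, add_zero] at this
    exact this
  intro w
  rw [← hb]
  refine (he' w).trans ⟨?_, ?_⟩
  · rintro ⟨c, rfl⟩
    exact ⟨c * u, by rw [map_mul, Module.End.mul_apply, hu]⟩
  · rintro ⟨c, rfl⟩
    exact ⟨c * b, by rw [map_mul, Module.End.mul_apply]⟩

theorem phi_sum_smul (j k : ℕ) {x : Ω} (hx : x ≠ 0) (θ : Fqk Fq Ω k) (c : ℕ → Fq) :
    phi Fq j k (gOf Fq j k x) (∑ i ∈ Finset.range k, C (c i) * (1 - X) ^ i) (θ • x)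
      = (∑ i ∈ Finset.range k, c i • (θ : Ω) ^ (Fintype.card Fq ^ (j * i))) * x := by
  rw [map_sum, LinearMap.sum_apply, Finset.sum_mul]
  refine Finset.sum_congr rfl fun i _ => ?_
  rw [smul_mul_assoc, ← one_sub_phiT_pow_smul j k hx, map_mul, ← algebraMap_eq,
    AlgHom.commutes, Module.End.mul_apply, Module.algebraMap_end_apply]
  simp [phi]

theorem FPoly_dvd_of_phi_eq_zero (j k : ℕ) (hk : 1 ≤ k) {x : Ω} (hx : x ≠ 0) (θ : Fqk Fq Ω k)
    (hθ : ∀ c : ℕ → Fq, ∑ i ∈ Finset.range k, c i • (θ : Ω) ^ (Fintype.card Fq ^ (j * i)) = 0 →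
        ∀ i < k, c i = 0)
    (b : Fq[X]) (hb : phi Fq j k (gOf Fq j k x) b (θ • x) = 0) : FPoly Fq k ∣ b := by
  have hmonic : (X ^ k - 1 : Fq[X]).Monic := monic_X_pow_sub_C 1 (by omega)
  -- The substitution `T ↦ 1 - T` turns `F` into `1 - T ^ k`; undoing it, the remainder is a
  -- combination of `(1 - T) ^ i` with `i < k`, hence a linear relation among conjugates of `θ`.
  set r := b.comp (1 - X) %ₘ (X ^ k - 1)
  have hdeg : r.natDegree < k := by
    have hnat : (X ^ k - 1 : Fq[X]).natDegree = k := natDegree_X_pow_sub_C (r := 1)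
    have := natDegree_modByMonic_lt (b.comp (1 - X)) hmonic
      (fun h => by rw [h, natDegree_one] at hnat; omega)
    rwa [hnat] at this
  have hdec : b = r.comp (1 - X) - FPoly Fq k * (b.comp (1 - X) /ₘ (X ^ k - 1)).comp (1 - X) := by
    have h1 := congrArg (fun p => p.comp (1 - X)) (modByMonic_add_div (b.comp (1 - X)) (X ^ k - 1))
    have h2 : b = (b.comp (1 - X)).comp (1 - X) := by simp [comp_assoc]
    simp only [add_comp, mul_comp, sub_comp, pow_comp, X_comp, one_comp] at h1
    simp only [r, FPoly]
    linear_combination h2 - h1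
  have hr : r.comp (1 - X) = ∑ i ∈ Finset.range k, C (r.coeff i) * (1 - X) ^ i := by
    conv_lhs => rw [r.as_sum_range_C_mul_X_pow' hdeg]
    simp
  have h0 : phi Fq j k (gOf Fq j k x) (r.comp (1 - X)) (θ • x) = 0 := by
    rw [hdec, map_sub, mul_comm, map_mul, LinearMap.sub_apply, Module.End.mul_apply] at hb
    have : phi Fq j k (gOf Fq j k x) (FPoly Fq k) (θ • x) = 0 := by
      change PhiTk Fq j k (gOf Fq j k x) (θ • x) = 0
      rw [map_smul, PhiTk_self j k hx, smul_zero]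
    rwa [this, map_zero, sub_zero] at hb
  rw [hr, phi_sum_smul j k hx, mul_eq_zero, or_iff_left hx] at h0
  have hz : r = 0 := by
    ext i
    by_cases hi : i < k
    · exact hθ _ h0 i hi
    · exact coeff_eq_zero_of_natDegree_lt (by omega)
  rw [hdec, hz]
  simp

/-- Over `A_k` the generator is `h`; over `A` it is `θ h` with `θ` normal, since the `A`-orbit of `θ
x` is then the whole line through `x`. -/
theorem mem_markedLevelSet_of_isMarked [IsAlgClosed Ω] (j k n : ℕ) (hk : 1 ≤ k)
    (hjk : Nat.Coprime j k) {x : Ω} (hx : x ≠ 0) (hn : 1 ≤ n)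
    {E : Submodule (Fqk Fq Ω k) Ω} (hE : IsMarked Fq j k n x E) :
    E ∈ markedLevelSet Fq j k n x := by
  obtain ⟨hstab, h, hh, hEh⟩ := hE
  have hphi : ∀ b : Fq[X], ∀ z ∈ E, phi Fq j k (gOf Fq j k x) b z ∈ E := by
    intro b
    induction b using Polynomial.induction_on' with
    | add p r hp hr => exact fun z hz => by rw [map_add]; exact E.add_mem (hp z hz) (hr z hz)
    | monomial s a =>
      induction s with
      | zero =>
        intro z hz
        have ha : algebraMap Fq Ω a ∈ Fqk Fq Ω k := by
          rw [mem_Fqk, ← map_pow, FiniteField.pow_card_pow]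
        rw [monomial_zero_left, ← algebraMap_eq, AlgHom.commutes, Module.algebraMap_end_apply,
          Algebra.smul_def]
        exact E.smul_mem ⟨_, ha⟩ hz
      | succ s ih =>
        intro z hz
        rw [← monomial_mul_X, map_mul, Module.End.mul_apply, ← phiT_eq_phi_X]
        exact ih _ (hstab z hz)
  have hhE : h ∈ E := (hEh h).2 ⟨1, by simp⟩
  have hPn := PhiTk_pow_generator j k n hn hx hh
  have hkill : ∀ z ∈ E, (PhiTk Fq j k (gOf Fq j k x) ^ n) z = 0 := by
    intro z hz
    obtain ⟨d, rfl⟩ := (hEh z).1 hz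
    rw [PhiTk_pow_aeval, hPn, map_zero]
  obtain ⟨θ, hθK, hθ, hspan⟩ := exists_normal_element_Fqk Fq (Ω := Ω) j k hjk hk
  set e := (⟨θ, hθK⟩ : Fqk Fq Ω k) • h
  have heE : e ∈ E := E.smul_mem _ hhE
  have hex : (PhiTk Fq j k (gOf Fq j k x) ^ (n - 1)) e = (⟨θ, hθK⟩ : Fqk Fq Ω k) • x := by
    rw [map_smul, hh]
  have hgen : ∀ i ≤ n, ∀ z ∈ E, (PhiTk Fq j k (gOf Fq j k x) ^ i) z = 0 →
      ∃ b, phi Fq j k (gOf Fq j k x) b e = z := by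
    intro i
    induction i with
    | zero => intro _ z _ hz; exact ⟨0, by simpa using hz.symm⟩
    | succ i ih =>
      intro hi z hz hz0
      obtain ⟨d, rfl⟩ := (hEh z).1 hz
      obtain ⟨d', hd'⟩ := exists_eq_aeval_of_pow_eq_zero j k n hx hh (i + 1) hi d hz0
      have hPi : (PhiTk Fq j k (gOf Fq j k x) ^ i) (aeval (PhiTk Fq j k (gOf Fq j k x)) d h)
          = d'.coeff 0 • x := by
        rw [hd', PhiTk_pow_aeval,
          ← Module.End.mul_apply (PhiTk Fq j k (gOf Fq j k x) ^ i), ← pow_add,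
          show i + (n - (i + 1)) = n - 1 by omega, hh,
          aeval_apply_of_apply_eq_zero _ _ (PhiTk_self j k hx)]
      obtain ⟨c, hc⟩ := hspan _ (d'.coeff 0).2
      set b0 : Fq[X] := ∑ l ∈ Finset.range k, C (c l) * (1 - X) ^ l
      have hb0 : phi Fq j k (gOf Fq j k x) b0 ((⟨θ, hθK⟩ : Fqk Fq Ω k) • x) = d'.coeff 0 • x := by
        rw [phi_sum_smul j k hx, hc]
        rfl
      -- Subtracting a multiple of `e` with the same image under `Φ_T ^ i` leaves an element killed
      -- by `Φ_T ^ i`.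
      obtain ⟨b1, hb1⟩ := ih (by omega)
        (aeval (PhiTk Fq j k (gOf Fq j k x)) d h
          - phi Fq j k (gOf Fq j k x) (b0 * FPoly Fq k ^ (n - 1 - i)) e)
        (E.sub_mem hz (hphi _ _ heE)) (by
          rw [map_sub, hPi, map_mul, Module.End.mul_apply, PhiTk_pow_phi, ← PhiTk_pow_apply,
            ← Module.End.mul_apply, ← pow_add, show i + (n - 1 - i) = n - 1 by omega, hex, hb0,
            sub_self])
      refine ⟨b1 + b0 * FPoly Fq k ^ (n - 1 - i), ?_⟩
      rw [map_add, LinearMap.add_apply, hb1, sub_add_cancel]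
  refine ⟨⟨fun z hz => by rw [Phi_X_pow_apply, hkill z hz], ?_, ?_⟩, ?_⟩
  · refine (isSubmoduleIsoQuot_iff _ _ _).2
      ⟨e, fun z => ⟨fun hz => hgen n le_rfl z hz (hkill z hz), ?_⟩, fun b => ⟨fun hb => ?_, ?_⟩⟩
    · rintro ⟨b, rfl⟩
      exact hphi b e heE
    · refine pow_dvd_of_aeval_eq_zero _ _ e n (fun b hb => ?_) b hb
      refine FPoly_dvd_of_phi_eq_zero j k hk hx ⟨θ, hθK⟩ hθ b ?_
      rw [← hex, PhiTk_pow_apply]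
      exact hb
    · rintro ⟨c, rfl⟩
      change phi Fq j k (gOf Fq j k x) _ e = 0
      rw [mul_comm, map_mul, Module.End.mul_apply, ← PhiTk_pow_apply, hkill e heE, map_zero]
  · refine (isSubmoduleIsoQuot_iff _ _ _).2 ⟨h, hEh, fun b =>
       ⟨X_pow_dvd_of_aeval_eq_zero j k n hx hh b, ?_⟩⟩
    rintro ⟨c, rfl⟩
    rw [mul_comm, map_mul, Module.End.mul_apply, aeval_PhiTk_X_pow, hPn, map_zero]
  -- `φ_f` acts on the line through `x` as the trace, so `μ h` with `μ` of trace one is a witness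
  -- for the marking.
  · obtain ⟨μ, hμ, htr⟩ := exists_trace_one Fq (Ω := Ω) k hk
    refine ⟨(⟨μ, hμ⟩ : Fqk Fq Ω k) • h, E.smul_mem _ hhE, ?_⟩
    rw [Phi_X_pow_apply, PhiTk_pow_phi, map_smul, hh, phi_fPoly_smul j k hk hjk hx, htr, one_mul]

end Good

/-! ### Chains of `λ` and their kernels -/

section Chains

variable {Fq Ω : Type*} [Field Fq] [Fintype Fq] [Field Ω] [Algebra Fq Ω]

variable (Fq) in
/-- The recursion `Q_{x_i}(x_{i+1}) = x_i` for `1 ≤ i < n`. -/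
def IsQChain (j k n : ℕ) (x : ℕ → Ω) : Prop :=
  ∀ i : ℕ, 1 ≤ i → i < n → Q Fq j k (x i) (x (i + 1)) = x i

variable {j k n : ℕ} {x : ℕ → Ω}

theorem IsQChain.ne_zero (h : IsQChain Fq j k n x) (hx : x 1 ≠ 0) (i : ℕ) (hi : i < n) :
    x (i + 1) ≠ 0 := by
  induction i with
  | zero => exact hx
  | succ i ih => exact ne_zero_of_Q_eq j k (ih (by omega)) (h (i + 1) (by omega) hi)

theorem IsQChain.lamProd_phiT (h : IsQChain Fq j k n x) (hx : x 1 ≠ 0) (l : ℕ) (hl : l < n)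
    (z : Ω) : lamProd Fq k x l (phiT Fq j k (gOf Fq j k (x 1)) z)
      = phiT Fq j k (gOf Fq j k (x (l + 1))) (lamProd Fq k x l z) := by
  induction l with
  | zero => rfl
  | succ l ih =>
    have hxl := h.ne_zero hx l (by omega)
    rw [lamProd, Module.End.mul_apply, ih (by omega), lam_phiT j k hxl,
      gNext_eq_gOf j k hxl (h (l + 1) (by omega) hl), Module.End.mul_apply]

theorem apply_aeval_of_intertwine {R V : Type*} [CommRing R] [AddCommGroup V] [Module R V]
    (A t t' : Module.End R V) (h : ∀ z, A (t z) = t' (A z)) (b : R[X]) (z : V) :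
    A (aeval t b z) = aeval t' b (A z) := by
  induction b using Polynomial.induction_on' generalizing z with
  | add p r hp hr => simp [hp, hr]
  | monomial s a =>
    induction s generalizing z with
    | zero => simp [← algebraMap_eq]
    | succ s ih =>
      rw [← monomial_mul_X, map_mul, map_mul, aeval_X, aeval_X, Module.End.mul_apply,
        Module.End.mul_apply, ih, h]

theorem IsQChain.lamProd_PhiTk (h : IsQChain Fq j k n x) (hx : x 1 ≠ 0) (l : ℕ) (hl : l < n)
    (z : Ω) : lamProd Fq k x l (PhiTk Fq j k (gOf Fq j k (x 1)) z)
      = PhiTk Fq j k (gOf Fq j k (x (l + 1))) (lamProd Fq k x l z) :=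
  apply_aeval_of_intertwine _ _ _ (h.lamProd_phiT hx l hl) _ z

/-- One step down the chain: `PhiTk_eq_Q_lam` applied to the image of `z` under the first `l`
factors, with `Q_{x_{l+1}}(x_{l+2}) = x_{l+1}`. -/
theorem IsQChain.lamProd_PhiTk_of_eq (h : IsQChain Fq j k n x) (hx : x 1 ≠ 0) (hk : 1 ≤ k)
    (hjk : Nat.Coprime j k) (l : ℕ) (hl : l + 1 < n) {z : Ω}
    (hz : lamProd Fq k x (l + 1) z = x (l + 2)) :
    lamProd Fq k x l (PhiTk Fq j k (gOf Fq j k (x 1)) z) = x (l + 1) := by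
  have hxl := h.ne_zero hx l (by omega)
  have hQ := h (l + 1) (by omega) hl
  rw [lamProd, Module.End.mul_apply] at hz
  rw [h.lamProd_PhiTk hx l (by omega), PhiTk_eq_Q_lam j k hk hjk hxl, hz, hQ]
  rw [lam_phiT j k hxl, hz, phiT_eq_zero_of_Q_eq j k hxl hQ]

theorem IsQChain.lamProd_PhiTk_pow (h : IsQChain Fq j k n x) (hx : x 1 ≠ 0) (hk : 1 ≤ k)
    (hjk : Nat.Coprime j k) {z : Ω} (hz : lamProd Fq k x (n - 1) z = x n) (l : ℕ) (hl : l < n) :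
    lamProd Fq k x l ((PhiTk Fq j k (gOf Fq j k (x 1)) ^ (n - 1 - l)) z) = x (l + 1) := by
  induction hs : n - 1 - l generalizing l with
  | zero => rw [show l = n - 1 by omega, Nat.sub_add_cancel (by omega)]; exact hz
  | succ s ih =>
    rw [pow_succ', Module.End.mul_apply]
    exact h.lamProd_PhiTk_of_eq hx hk hjk l (by omega) (ih (l + 1) (by omega) (by omega))

theorem lamProd_eq_zero_of_le {l i : ℕ} (hil : i ≤ l) {z : Ω} (hz : lamProd Fq k x i z = 0) :
    lamProd Fq k x l z = 0 := by
  induction l, hil using Nat.le_induction with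
  | base => exact hz
  | succ l _ ih => rw [lamProd, Module.End.mul_apply, ih, map_zero]

theorem lam_self (k : ℕ) {x : Ω} (hx : x ≠ 0) : lam Fq k x x = 0 :=
  (lam_eq_zero_iff k hx x).2 ⟨1, (one_smul _ _).symm⟩

theorem lamProd_aeval_eq_zero (P : Module.End (Fqk Fq Ω k) Ω) (v : Ω) (l : ℕ)
    (h : ∀ s, lamProd Fq k x l ((P ^ s) v) = 0) (d : (Fqk Fq Ω k)[X]) :
    lamProd Fq k x l (aeval P d v) = 0 := by
  rw [aeval_endomorphism, Polynomial.sum_def, map_sum]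
  exact Finset.sum_eq_zero fun s _ => by rw [lamProd_smul, h, smul_zero]

theorem lamProd_pow_eq_zero (P : Module.End (Fqk Fq Ω k) Ω) (h : Ω) (hP : (P ^ n) h = 0) (l : ℕ)
    (hl : l ≤ n) (hx : ∀ i < l, x (i + 1) ≠ 0)
    (hh : ∀ i < l, lamProd Fq k x i ((P ^ (n - 1 - i)) h) = x (i + 1)) (s : ℕ) (hs : n - l ≤ s) :
    lamProd Fq k x l ((P ^ s) h) = 0 := by
  by_cases hsn : n ≤ s
  · rw [← Nat.sub_add_cancel hsn, pow_add, Module.End.mul_apply, hP, map_zero, map_zero]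
  -- The first `n - 1 - s` factors send `P ^ s h` to `x_{n-s}`, which the next factor kills.
  · refine lamProd_eq_zero_of_le (i := n - 1 - s + 1) (by omega) ?_
    have := hh (n - 1 - s) (by omega)
    rw [show n - 1 - (n - 1 - s) = s by omega] at this
    rw [lamProd, Module.End.mul_apply, this, lam_self k (hx _ (by omega))]

theorem lamProd_eq_zero_iff (P : Module.End (Fqk Fq Ω k) Ω) (h : Ω) (hP : (P ^ n) h = 0)
    (hx : ∀ i < n, x (i + 1) ≠ 0)
    (hh : ∀ i < n, lamProd Fq k x i ((P ^ (n - 1 - i)) h) = x (i + 1)) (z : Ω) :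
    lamProd Fq k x n z = 0 ↔ ∃ d : (Fqk Fq Ω k)[X], aeval P d h = z := by
  constructor
  · suffices ∀ l ≤ n, ∀ z, lamProd Fq k x l z = 0 → ∃ d : (Fqk Fq Ω k)[X], aeval P d h = z from
      this n le_rfl z
    intro l
    induction l with
    | zero => exact fun _ z hz => ⟨0, by simpa [lamProd] using hz.symm⟩
    | succ l ih =>
      intro hl z hz
      rw [lamProd, Module.End.mul_apply, lam_eq_zero_iff k (hx l hl)] at hz
      obtain ⟨μ, hμ⟩ := hz
      -- `P ^ (n - 1 - l) h` maps to `x_{l+1}`, so this multiple of it cancels the image of `z`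
      -- under the first `l` factors.
      obtain ⟨d, hd⟩ := ih (by omega) (z - μ • (P ^ (n - 1 - l)) h) (by
        rw [map_sub, lamProd_smul, hh l hl, hμ, sub_self])
      refine ⟨d + C μ * X ^ (n - 1 - l), ?_⟩
      rw [map_add, LinearMap.add_apply, hd, map_mul, map_pow, aeval_X, aeval_C,
        Module.End.mul_apply, Module.algebraMap_end_apply, sub_add_cancel]
  · rintro ⟨d, rfl⟩
    exact lamProd_aeval_eq_zero P h n
      (fun s => lamProd_pow_eq_zero P h hP n le_rfl hx hh s (by omega)) d

theorem IsQChain.PhiTk_pow_eq_zero (h : IsQChain Fq j k n x) (hx : x 1 ≠ 0) (l : ℕ) (hl : l ≤ n)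
    (z : Ω) (hz : lamProd Fq k x l z = 0) : (PhiTk Fq j k (gOf Fq j k (x 1)) ^ l) z = 0 := by
  induction l generalizing z with
  | zero => exact hz
  | succ l ih =>
    have hxl := h.ne_zero hx l hl
    rw [lamProd, Module.End.mul_apply, lam_eq_zero_iff k hxl] at hz
    obtain ⟨μ, hμ⟩ := hz
    rw [pow_succ, Module.End.mul_apply]
    refine ih (by omega) _ ?_
    rw [h.lamProd_PhiTk hx l hl, hμ, map_smul, PhiTk_self j k hxl, smul_zero]

/-- Each entry is the image of `Φ_T ^ (n - 1 - l) z` under the product built from the earlier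
entries, so `z` and `x 1` determine the chain. -/
theorem IsQChain.eq_of_lamProd_eq {x' : ℕ → Ω} (h : IsQChain Fq j k n x)
    (h' : IsQChain Fq j k n x') (hx : x 1 ≠ 0) (hxx : x' 1 = x 1) (hk : 1 ≤ k)
    (hjk : Nat.Coprime j k) {z : Ω} (hz : lamProd Fq k x (n - 1) z = x n)
    (hz' : lamProd Fq k x' (n - 1) z = x' n) (l : ℕ) (hl : l < n) : x (l + 1) = x' (l + 1) := by
  suffices ∀ l < n, lamProd Fq k x l = lamProd Fq k x' l ∧ x (l + 1) = x' (l + 1) from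
    (this l hl).2
  intro l
  induction l with
  | zero => exact fun _ => ⟨rfl, hxx.symm⟩
  | succ l ih =>
    intro hl
    obtain ⟨h1, h2⟩ := ih (by omega)
    have h3 : lamProd Fq k x (l + 1) = lamProd Fq k x' (l + 1) := by
      rw [lamProd, lamProd, h1, h2]
    refine ⟨h3, ?_⟩
    rw [← h.lamProd_PhiTk_pow hx hk hjk hz (l + 1) hl,
      ← h'.lamProd_PhiTk_pow (hxx ▸ hx) hk hjk hz' (l + 1) hl, h3, hxx]

theorem lamProd_congr {x' : ℕ → Ω} (l : ℕ) (h : ∀ i < l, x (i + 1) = x' (i + 1)) :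
    lamProd Fq k x l = lamProd Fq k x' l := by
  induction l with
  | zero => rfl
  | succ l ih => rw [lamProd, lamProd, ih fun i hi => h i (by omega), h l (by omega)]

theorem IsMarked.exists_isQChain {x₁ : Ω} (hx₁ : x₁ ≠ 0) (hk : 1 ≤ k) (hjk : Nat.Coprime j k)
    (hn : 1 ≤ n) {E : Submodule (Fqk Fq Ω k) Ω} (hE : IsMarked Fq j k n x₁ E) :
    ∃ x : ℕ → Ω, x 1 = x₁ ∧ IsQChain Fq j k n x ∧ (∀ z, z ∈ E ↔ lamProd Fq k x n z = 0) := by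
  obtain ⟨hstab, h, hh, hEh⟩ := hE
  have hPn := PhiTk_pow_generator j k n hn hx₁ hh
  set P := PhiTk Fq j k (gOf Fq j k x₁) with hP
  -- Entries and products depend on each other; the products are built first and the entries read
  -- off.
  let Λ : ℕ → Module.End Fq Ω :=
    Nat.rec 1 fun l A => lam Fq k (A ((P ^ (n - 1 - l)) h)) * A
  let x : ℕ → Ω := fun i => Λ (i - 1) ((P ^ (n - 1 - (i - 1))) h)
  have hΛ : ∀ l, lamProd Fq k x l = Λ l := by
    intro l
    induction l with
    | zero => rfl
    | succ l ih => rw [lamProd, ih]; rfl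
  have hxl : ∀ l, lamProd Fq k x l ((P ^ (n - 1 - l)) h) = x (l + 1) := fun l => by rw [hΛ]; rfl
  have hx1 : x 1 = x₁ := hh
  have hchain : ∀ l ≤ n, IsQChain Fq j k l x := by
    intro l
    induction l with
    | zero => exact fun _ i _ hi => absurd hi (by omega)
    | succ l ih =>
      intro hl i hi1 hi2
      have hc := ih (by omega)
      rcases Nat.lt_succ_iff_lt_or_eq.1 hi2 with hi | rfl
      · exact hc i hi1 hi
      obtain ⟨l, rfl⟩ : ∃ l, i = l + 1 := ⟨i - 1, by omega⟩
      have hne := hc.ne_zero (hx1 ▸ hx₁)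
      set z := (P ^ (n - 1 - (l + 1))) h with hz
      have hPz : lamProd Fq k x l (P z) = x (l + 1) := by
        rw [← hxl l, hz, ← Module.End.mul_apply, ← pow_succ',
          show n - 1 - (l + 1) + 1 = n - 1 - l by omega]
      have hint := hc.lamProd_PhiTk (hx1 ▸ hx₁) l (by omega) z
      have hintT := hc.lamProd_phiT (hx1 ▸ hx₁) l (by omega) z
      rw [hx1] at hint hintT
      rw [← hP, hPz] at hint
      have hzE : z ∈ E := (hEh z).2 ⟨X ^ (n - 1 - (l + 1)), by rw [map_pow, aeval_X]⟩
      -- `P ^ (l + 1)` sends `φ_T z` to `φ_T x₁ = 0`. As `φ_T z` lies in `E`, it is an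
      -- `A_k`-multiple of `P ^ (n - (l + 1)) h`, which the first `l + 1` factors kill.
      have hzero : lamProd Fq k x (l + 1) (phiT Fq j k (gOf Fq j k x₁) z) = 0 := by
        obtain ⟨d, hd⟩ := (hEh _).1 (hstab z hzE)
        obtain ⟨d', hd'⟩ := exists_eq_aeval_of_pow_eq_zero j k n hx₁ hh (l + 1) (by omega) d (by
          rw [← hP, hd, phiT_eq_phi_X, hP, PhiTk_pow_phi, ← hP, hz,
            ← Module.End.mul_apply (P ^ (l + 1)), ← pow_add,
            show l + 1 + (n - 1 - (l + 1)) = n - 1 by omega, hh, ← phiT_eq_phi_X,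
            phiT_gOf_self j k hx₁])
        rw [← hd, hd']
        refine lamProd_aeval_eq_zero P _ _ (fun s => ?_) d'
        rw [← hP, ← Module.End.mul_apply, ← pow_add]
        exact lamProd_pow_eq_zero P h hPn (l + 1) (by omega) hne (fun i _ => hxl i) _ (by omega)
      rw [lamProd, Module.End.mul_apply, hintT] at hzero
      rw [← hxl (l + 1), lamProd, Module.End.mul_apply,
        ← PhiTk_eq_Q_lam j k hk hjk (hne l (by omega)) hzero, ← hint]
  refine ⟨x, hx1, hchain n le_rfl, fun z => ?_⟩
  rw [hEh, lamProd_eq_zero_iff P h hPn ((hchain n le_rfl).ne_zero (hx1 ▸ hx₁))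
    (fun i _ => hxl i)]

theorem lam_surjective [IsAlgClosed Ω] (hk : 1 ≤ k) {x : Ω} (hx : x ≠ 0) :
    Function.Surjective (lam Fq k x) := by
  intro w
  have hdeg : (X ^ (Fintype.card Fq ^ k) - (C (x ^ (Fintype.card Fq ^ k) / x) * X - C w)
      : Polynomial Ω).degree = (Fintype.card Fq ^ k : ℕ) := by
    rw [degree_sub_eq_left_of_degree_lt, degree_X_pow]
    rw [degree_X_pow]
    refine (degree_sub_le _ _).trans_lt (max_lt ((degree_C_mul_X_le _).trans_lt ?_)
      (degree_C_le.trans_lt ?_))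
    · exact_mod_cast Nat.one_lt_pow (by omega) Fintype.one_lt_card
    · exact_mod_cast pow_pos Fintype.card_pos k
  obtain ⟨z, hz⟩ := IsAlgClosed.exists_root _ (by
    rw [hdeg]
    exact_mod_cast (pow_pos Fintype.card_pos k).ne')
  refine ⟨z, ?_⟩
  simp only [IsRoot.def, eval_sub, eval_mul, eval_pow, eval_X, eval_C] at hz
  rw [lam_apply k hx]
  linear_combination -hz

theorem IsQChain.lamProd_surjective [IsAlgClosed Ω] (h : IsQChain Fq j k n x) (hx : x 1 ≠ 0)
    (hk : 1 ≤ k) (l : ℕ) (hl : l ≤ n) : Function.Surjective (lamProd Fq k x l) := by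
  induction l with
  | zero => exact fun z => ⟨z, rfl⟩
  | succ l ih =>
    exact (lam_surjective hk (h.ne_zero hx l hl)).comp (ih (by omega))

theorem IsQChain.isMarked [IsAlgClosed Ω] (h : IsQChain Fq j k n x) (hx : x 1 ≠ 0) (hk : 1 ≤ k)
    (hjk : Nat.Coprime j k) (hn : 1 ≤ n) {E : Submodule (Fqk Fq Ω k) Ω}
    (hE : ∀ z, z ∈ E ↔ lamProd Fq k x n z = 0) :
    IsMarked Fq j k n (x 1) E ∧
      (∃ z ∈ E, (PhiTk Fq j k (gOf Fq j k (x 1)) ^ (n - 1)) z = x 1) ∧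
      ∀ z ∈ E, (PhiTk Fq j k (gOf Fq j k (x 1)) ^ (n - 1)) z = x 1 →
        lamProd Fq k x (n - 1) z = x n := by
  obtain ⟨n, rfl⟩ : ∃ l, n = l + 1 := ⟨n - 1, by omega⟩
  rw [add_tsub_cancel_right]
  have hxn := h.ne_zero hx n (by omega)
  obtain ⟨z₀, hz₀⟩ := h.lamProd_surjective hx hk n (by omega) (x (n + 1))
  have hpow := h.lamProd_PhiTk_pow hx hk hjk (z := z₀) (by simpa using hz₀)
  have h1 : (PhiTk Fq j k (gOf Fq j k (x 1)) ^ n) z₀ = x 1 := hpow 0 (by omega)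
  have hEz := lamProd_eq_zero_iff _ z₀ (PhiTk_pow_generator j k (n + 1) hn hx h1)
    (h.ne_zero hx) hpow
  refine ⟨⟨fun z hz => ?_, z₀, h1, fun z => by rw [hE, hEz]⟩, ⟨z₀, ?_, h1⟩, fun z hz hz1 => ?_⟩
  · rw [hE, lamProd, Module.End.mul_apply] at hz
    rw [hE, lamProd, Module.End.mul_apply, h.lamProd_phiT hx n (by omega), lam_phiT j k hxn, hz,
      map_zero]
  · rw [hE, lamProd, Module.End.mul_apply, hz₀, lam_self k hxn]
  · rw [hE, lamProd, Module.End.mul_apply, lam_eq_zero_iff k hxn] at hz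
    obtain ⟨μ, hμ⟩ := hz
    have h2 := h.PhiTk_pow_eq_zero hx n (by omega) (z - μ • z₀) (by
      rw [map_sub, lamProd_smul, hz₀, hμ, sub_self])
    rw [map_sub, map_smul, hz1, h1, sub_eq_zero] at h2
    -- `z - μ z₀` is killed by the first `n` factors, hence by `Φ_T ^ n`; comparing images gives `x
    -- 1 = μ x 1`.
    have hμ1 : μ = 1 := smul_left_injective _ hx (h2.symm.trans (one_smul _ (x 1)).symm)
    rw [hμ, hμ1, one_smul]

end Chains

/-! ### Counting the solution tuples -/

section Counting

theorem seq_one {Ω : Type*} (n : ℕ) (x₁ : Ω) (y : Fin (n - 1) → Ω) : seq n x₁ y 1 = x₁ := by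
  simp [seq]

theorem seq_eq {Ω : Type*} (n : ℕ) (x : ℕ → Ω) (i : ℕ) (hi : i < n) :
    seq n (x 1) (fun l : Fin (n - 1) => x (l + 2)) (i + 1) = x (i + 1) := by
  by_cases h : 1 ≤ i
  · rw [seq, dif_pos (by omega)]
    exact congrArg x (by simp only; omega)
  · rw [show i = 0 by omega, seq_one]

theorem eq_of_seq_eq {Ω : Type*} (n : ℕ) (x₁ : Ω) (y y' : Fin (n - 1) → Ω)
    (h : ∀ i < n, seq n x₁ y (i + 1) = seq n x₁ y' (i + 1)) : y = y' := by
  funext l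
  have hl := l.2
  have := h (l + 1) (by omega)
  rw [seq, seq, dif_pos (by omega), dif_pos (by omega)] at this
  exact this

theorem seq_cons {Ω : Type*} (l : ℕ) (x₁ b : Ω) (y : Fin l → Ω) (i : ℕ) (hi : i < l + 1) :
    seq (l + 2) x₁ (Fin.cons b y : Fin (l + 1) → Ω) (i + 2) = seq (l + 1) b y (i + 1) := by
  rcases i with _ | i
  · rw [seq_one, seq, dif_pos (by omega)]
    rfl
  · rw [seq, seq, dif_pos (by omega), dif_pos (by omega)]
    rfl

variable {Fq Ω : Type*} [Field Fq] [Fintype Fq] [Field Ω] [Algebra Fq Ω]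

theorem cons_mem_solutionSet_iff (j k l : ℕ) (x₁ b : Ω) (y : Fin l → Ω) :
    (Fin.cons b y : Fin (l + 1) → Ω) ∈ solutionSet Fq j k (l + 2) x₁ ↔
      Q Fq j k x₁ b = x₁ ∧ y ∈ solutionSet Fq j k (l + 1) b := by
  have h2 : seq (l + 2) x₁ (Fin.cons b y : Fin (l + 1) → Ω) 2 = b := by
    rw [seq_cons l x₁ b y 0 (by omega), seq_one]
  constructor
  · intro h
    refine ⟨?_, fun i h1 hi => ?_⟩
    · have := h 1 le_rfl (by omega)
      rwa [seq_one, h2] at this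
    · obtain ⟨i, rfl⟩ : ∃ s, i = s + 1 := ⟨i - 1, by omega⟩
      have := h (i + 2) (by omega) (by omega)
      rwa [seq_cons l x₁ b y i (by omega), seq_cons l x₁ b y (i + 1) (by omega)] at this
  · rintro ⟨hb, hy⟩ i h1 hi
    rcases i with _ | _ | i
    · omega
    · rw [seq_one, h2, hb]
    · rw [seq_cons l x₁ b y i (by omega), seq_cons l x₁ b y (i + 1) (by omega)]
      exact hy (i + 1) (by omega) (by omega)

/-- `Q_x` has `τ`-degree `j + k - 1` and all its coefficients are nonzero; the nonzero linear term
makes the equation separable. -/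
theorem card_Q_eq [IsAlgClosed Ω] (j k : ℕ) (hj : 1 ≤ j) (hk : 1 ≤ k) {x : Ω} (hx : x ≠ 0) :
    Nat.card {y : Ω // Q Fq j k x y = x} = Fintype.card Fq ^ (j + k - 1) := by
  rw [← card_zeros_additive Fq (Ω := Ω) (j + k - 1)
    (fun i => if i < j then x / x ^ (Fintype.card Fq ^ (k + i))
      else x / x ^ (Fintype.card Fq ^ (i - j))) x]
  · refine Nat.card_congr (Equiv.subtypeEquivRight fun y => ?_)
    rw [Q_apply j k hx, Nat.sub_add_cancel (by omega), Finset.sum_range_add]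
    refine Eq.congr (congrArg₂ _ (Finset.sum_congr rfl fun i hi => ?_)
      (Finset.sum_congr rfl fun i _ => ?_)) rfl
    · rw [if_pos (Finset.mem_range.1 hi)]
    · rw [if_neg (by omega), Nat.add_sub_cancel_left]
  · rw [if_pos (by omega)]
    exact div_ne_zero hx (pow_ne_zero _ hx)
  · split_ifs <;> exact div_ne_zero hx (pow_ne_zero _ hx)

theorem card_solutionSet_succ [IsAlgClosed Ω] (j k l : ℕ) (hj : 1 ≤ j) (hk : 1 ≤ k) {x : Ω}
    (hx : x ≠ 0) : Nat.card (solutionSet Fq j k (l + 1) x)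
      = Fintype.card Fq ^ ((j + k - 1) * l) := by
  induction l generalizing x with
  | zero =>
    have huniv : solutionSet Fq j k (0 + 1) x = {fun i => i.elim0} := by
      ext y
      simp only [Set.mem_singleton_iff]
      exact ⟨fun _ => funext fun i => i.elim0, fun _ i h1 hi => by omega⟩
    rw [huniv]
    simp
  | succ l ih =>
    let e : solutionSet Fq j k (l + 2) x ≃
        Σ b : {b : Ω // Q Fq j k x b = x}, solutionSet Fq j k (l + 1) b.1 :=
      { toFun := fun y =>
          have h := (cons_mem_solutionSet_iff (Fq := Fq) j k l x (y.1 (0 : Fin (l + 1)))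
            (Fin.tail (y.1 : Fin (l + 1) → Ω))).1 (by rw [Fin.cons_self_tail]; exact y.2)
          ⟨⟨_, h.1⟩, ⟨_, h.2⟩⟩
        invFun := fun p => ⟨(Fin.cons p.1.1 p.2.1 : Fin (l + 1) → Ω),
          (cons_mem_solutionSet_iff j k l x p.1.1 p.2.1).2 ⟨p.1.2, p.2.2⟩⟩
        left_inv := fun y => Subtype.ext (Fin.cons_self_tail (y.1 : Fin (l + 1) → Ω))
        right_inv := fun p => rfl }
    have hcard := card_Q_eq (Fq := Fq) j k hj hk hx
    have : Finite {b : Ω // Q Fq j k x b = x} :=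
      Nat.finite_of_card_ne_zero (by rw [hcard]; simp)
    have : Fintype {b : Ω // Q Fq j k x b = x} := Fintype.ofFinite _
    have hne : ∀ b : {b : Ω // Q Fq j k x b = x}, Nat.card (solutionSet Fq j k (l + 1) b.1)
        = Fintype.card Fq ^ ((j + k - 1) * l) := fun b => ih (ne_zero_of_Q_eq j k hx b.2)
    have : ∀ b : {b : Ω // Q Fq j k x b = x}, Finite (solutionSet Fq j k (l + 1) b.1) :=
      fun b => Nat.finite_of_card_ne_zero (by rw [hne]; simp)
    rw [Nat.card_congr e, Nat.card_sigma, Finset.sum_congr rfl fun b _ => hne b,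
      Finset.sum_const, Finset.card_univ, ← Nat.card_eq_fintype_card, hcard, smul_eq_mul,
      ← pow_add]
    congr 1
    ring

end Counting

/-! ### Assembling the bijection -/

theorem exists_equiv_of_existsUnique {α β : Type*} (r : α → β → Prop) (h : ∀ a, ∃! b, r a b)
    (h' : ∀ b, ∃! a, r a b) : ∃ e : α ≃ β, ∀ a b, e a = b ↔ r a b := by
  choose f hf hf' using h
  refine ⟨Equiv.ofBijective f ⟨fun a a' haa => ?_, fun b => ?_⟩, fun a b => ?_⟩
  · exact (h' (f a)).unique (hf a) (haa ▸ hf a')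
  · obtain ⟨a, ha, -⟩ := h' b
    exact ⟨a, (hf' a b ha).symm⟩
  · exact ⟨fun hab => hab ▸ hf a, fun hab => (hf' a b hab).symm⟩

end DrinfeldTower

open DrinfeldTower in
theorem mainTheorem3 {Fq Ω : Type*} [Field Fq] [Fintype Fq] [Field Ω] [IsAlgClosed Ω]
    [Algebra Fq Ω] (m j k n : ℕ) (hm : m = j + k) (hj : 1 ≤ j) (hk : 1 ≤ k)
    (hjk : Nat.Coprime j k) (hpk : ¬ ringChar Fq ∣ k) (hn : 2 ≤ n) (x₁ : Ω) (hx₁ : x₁ ≠ 0) :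
    (∃ Θ : DrinfeldTower.markedLevelSet Fq j k n x₁ ≃ DrinfeldTower.solutionSet Fq j k n x₁,
      ∀ (E : DrinfeldTower.markedLevelSet Fq j k n x₁)
        (y : DrinfeldTower.solutionSet Fq j k n x₁),
        Θ E = y ↔
          ((E.1 : Set Ω) =
            {z : Ω | DrinfeldTower.lamProd Fq k (DrinfeldTower.seq n x₁ y.1) n z = 0}) ∧
          (∃ h ∈ E.1, DrinfeldTower.Phi Fq j k (DrinfeldTower.gOf Fq j k x₁)
            (Polynomial.X ^ (n - 1)) h = x₁) ∧
          (∀ h ∈ E.1, DrinfeldTower.Phi Fq j k (DrinfeldTower.gOf Fq j k x₁)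
            (Polynomial.X ^ (n - 1)) h = x₁ →
            DrinfeldTower.lamProd Fq k (DrinfeldTower.seq n x₁ y.1) (n - 1) h
              = DrinfeldTower.seq n x₁ y.1 n)) ∧
    Nat.card (DrinfeldTower.markedLevelSet Fq j k n x₁)
      = Fintype.card Fq ^ ((m - 1) * (n - 1)) ∧
    Nat.card (DrinfeldTower.solutionSet Fq j k n x₁)
      = Fintype.card Fq ^ ((m - 1) * (n - 1)) := by
  subst hm
  have hcard : Nat.card (solutionSet Fq j k n x₁)
      = Fintype.card Fq ^ ((j + k - 1) * (n - 1)) := by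
    obtain ⟨l, rfl⟩ : ∃ l, n = l + 1 := ⟨n - 1, by omega⟩
    exact card_solutionSet_succ j k l hj hk hx₁
  -- Only the bijection remains; it transports the count of tuples to the level structures.
  suffices hΘ : _ from ⟨hΘ, (Nat.card_congr hΘ.choose).trans hcard, hcard⟩
  have hs1 : ∀ y : Fin (n - 1) → Ω, seq n x₁ y 1 ≠ 0 := fun y => by rwa [seq_one]
  have key : ∀ (y : solutionSet Fq j k n x₁) (E : Submodule (Fqk Fq Ω k) Ω),
      (E : Set Ω) = {z : Ω | lamProd Fq k (seq n x₁ y.1) n z = 0} →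
      E ∈ markedLevelSet Fq j k n x₁ ∧
      (∃ h ∈ E, Phi Fq j k (gOf Fq j k x₁) (Polynomial.X ^ (n - 1)) h = x₁) ∧
      (∀ h ∈ E, Phi Fq j k (gOf Fq j k x₁) (Polynomial.X ^ (n - 1)) h = x₁ →
        lamProd Fq k (seq n x₁ y.1) (n - 1) h = seq n x₁ y.1 n) := by
    intro y E hE
    have hchain : IsQChain Fq j k n (seq n x₁ y.1) := y.2
    obtain ⟨h1, h2, h3⟩ := hchain.isMarked (hs1 y.1) hk hjk (by omega) (E := E)
      fun z => Set.ext_iff.1 hE z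
    simp only [seq_one] at h1 h2 h3
    simp only [Phi_X_pow_apply]
    exact ⟨mem_markedLevelSet_of_isMarked j k n hk hjk hx₁ (by omega) h1, h2, h3⟩
  refine exists_equiv_of_existsUnique _ (fun E => ?_) (fun y => ?_)
  · obtain ⟨x, rfl, hx, hEx⟩ := (isMarked_of_mem_markedLevelSet j k n hx₁ (by omega)
      E.2).exists_isQChain hx₁ hk hjk (by omega)
    have hseq := seq_eq n x
    have hy : (fun l : Fin (n - 1) => x (l + 2)) ∈ solutionSet Fq j k n (x 1) := by
      intro i h1 hi
      obtain ⟨i, rfl⟩ : ∃ s, i = s + 1 := ⟨i - 1, by omega⟩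
      rw [hseq i (by omega), hseq (i + 1) hi]
      exact hx (i + 1) h1 hi
    have hEy : (E.1 : Set Ω) = {z : Ω | lamProd Fq k (seq n (x 1) fun l => x (l + 2)) n z = 0} := by
      rw [lamProd_congr n hseq]
      exact Set.ext hEx
    refine ⟨⟨_, hy⟩, ⟨hEy, (key ⟨_, hy⟩ E.1 hEy).2⟩, fun y' hy' => Subtype.ext ?_⟩
    obtain ⟨-, ⟨h, hhE, hh⟩, hall⟩ := hy'
    have hc : IsQChain Fq j k n (seq n (x 1) y'.1) := y'.2
    have hc' : IsQChain Fq j k n (seq n (x 1) fun l => x (l + 2)) := hy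
    -- Both tuples satisfy (II) for the same `h`, which determines the chain.
    exact eq_of_seq_eq n (x 1) _ _ fun i hi => hc.eq_of_lamProd_eq hc' (hs1 _)
      (by rw [seq_one, seq_one]) hk hjk (hall h hhE hh)
      ((key ⟨_, hy⟩ E.1 hEy).2.2 h hhE hh) i hi
  · let E : Submodule (Fqk Fq Ω k) Ω :=
      { carrier := {z : Ω | lamProd Fq k (seq n x₁ y.1) n z = 0}
        add_mem' := fun {a b} ha hb => by
          simp only [Set.mem_ofPred_eq] at ha hb ⊢
          rw [map_add, ha, hb, add_zero]
        zero_mem' := map_zero _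
        smul_mem' := fun c z hz => by
          simp only [Set.mem_ofPred_eq] at hz ⊢
          rw [lamProd_smul, hz, smul_zero] }
    obtain ⟨h1, h2⟩ := key y E rfl
    exact ⟨⟨E, h1⟩, ⟨rfl, h2⟩, fun E' hE' => Subtype.ext (SetLike.coe_injective hE'.1)⟩
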